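/- Let $\mathbb{H}^2$ be the hyperbolic plane. A \emph{(complete) constant curvature curve} is a subset of $\mathbb{H}^2$ that is the image of a smooth unit-speed curve $\gamma:\mathbb{R}\to\mathbb{H}^2$, defined on the whole real line, whose geodesic curvature is constant; these are exactly the complete geodesics, the circles of positive radius, the horocycles and the hypercycles. Let $f:\mathbb{H}^2\to\mathbb{H}^2$ be a bijection, not assumed to be continuous, such that for every constant curvature curve $C$ the image $f(C)$ is again a constant curvature curve, possibly of a different type and with a different curvature. Then $f$ is an isometry of $\mathbb{H}^2$. -/

import Mathlib

open scoped ContDiff ComplexConjugate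

namespace HyperbolicPlane

/-- The hyperbolic Riemannian metric `(dx² + dy²) / y²` on the upper half-plane, at the point `z`,
applied to the tangent vectors `v` and `w` (written as complex numbers `v = v₁ + v₂ i`). -/
noncomputable def metricInner (z : UpperHalfPlane) (v w : ℂ) : ℝ :=
  (v * conj w).re / z.im ^ 2

/-- The velocity of a curve in the upper half-plane. -/
noncomputable def velocity (γ : ℝ → UpperHalfPlane) (t : ℝ) : ℂ :=
  deriv (fun s : ℝ => (γ s : ℂ)) t

/-- The covariant derivative of the velocity along the curve, for the Levi-Civita connection of the
hyperbolic metric. The nonzero Christoffel symbols of this metric are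
`Γˣ_xy = Γˣ_yx = -1/y`, `Γʸ_xx = 1/y`, `Γʸ_yy = -1/y`, so the covariant acceleration of
`γ = x + i y` has the components `x'' - 2 x' y' / y` and `y'' + (x'² - y'²) / y`. -/
noncomputable def covariantAcceleration (γ : ℝ → UpperHalfPlane) (t : ℝ) : ℂ :=
  let v := velocity γ t
  let a := deriv (velocity γ) t
  let y := (γ t).im
  ⟨a.re - 2 * v.re * v.im / y, a.im + (v.re ^ 2 - v.im ^ 2) / y⟩

/-- A smooth curve, defined on the whole real line (so that it is complete), which has hyperbolic
speed one at every time. -/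
structure IsUnitSpeedCurve (γ : ℝ → UpperHalfPlane) : Prop where
  smooth : ContDiff ℝ ∞ (fun t : ℝ => (γ t : ℂ))
  unit_speed : ∀ t : ℝ, metricInner (γ t) (velocity γ t) (velocity γ t) = 1

/-- The (signed) geodesic curvature of a unit-speed curve: the component of its covariant
acceleration along the unit normal `i γ'`. -/
noncomputable def geodesicCurvature (γ : ℝ → UpperHalfPlane) (t : ℝ) : ℝ :=
  metricInner (γ t) (covariantAcceleration γ t) (Complex.I * velocity γ t)

/-- A set of points of the hyperbolic plane is a (complete) constant curvature curve when it is the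
image of a smooth unit-speed curve on the whole real line with constant geodesic curvature. -/
def IsConstantCurvatureCurve (C : Set UpperHalfPlane) : Prop :=
  ∃ γ : ℝ → UpperHalfPlane, IsUnitSpeedCurve γ ∧
    (∃ κ : ℝ, ∀ t : ℝ, geodesicCurvature γ t = κ) ∧ Set.range γ = C

end HyperbolicPlane

/-! Integrating the curvature equation shows that the constant curvature curves are exactly the
nonempty traces on the half-plane of Euclidean circles and lines (`isConstantCurvatureCurve_iff`).
Hence three distinct points lie on exactly one of them (`existsUnique_curve`), and the inverse of a
curve-preserving bijection preserves curves too (`PreservesCurves.symm`).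

The types of curve are told apart by an incidence count that needs no topology. Given `C`, a point
`p` and a point `q` off `C`, count the curves through `q` that meet `C` only in `p`. For a circle
there is at most one, the tangent one. For a horocycle there are at most two: the tangent one, and
one that crosses at `p` and leaves through the ideal point of the horocycle. For a geodesic or a
hypercycle a suitable choice of `p` and `q` gives infinitely many. So `f` maps circles to circles,
and after composition with an isometry it maps a horizontal line to a horizontal line
(`PreservesCurves.exists_isometry_image_horizontal`).

Such a normalized map preserves the families of horizontal and of vertical lines, hence the extreme
points of Euclidean circles. The heights then satisfy Jensen's equation on the positive reals;
positivity and surjectivity replace continuity and force `y ↦ k * y` (`eq_mul_of_jensen`).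
Horizontal distances scale by the same `k`, so hyperbolic distances are preserved. -/

namespace HyperbolicPlane
open UpperHalfPlane

/-! ### Integrating the curvature equation -/

/-- The first-order system satisfied by the unit-speed curves of constant curvature `κ`. -/
structure IsFlowLine (κ A B : ℝ) (γ : ℝ → ℍ) : Prop where
  re_deriv : ∀ t, HasDerivAt (fun s => (γ s).re) ((γ t).im * (κ + A * (γ t).im)) t
  im_deriv : ∀ t, HasDerivAt (fun s => (γ s).im) ((γ t).im * (B - A * (γ t).re)) t
  unit : ∀ t, (κ + A * (γ t).im) ^ 2 + (B - A * (γ t).re) ^ 2 = 1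

theorem hasDerivAt_mk {x y : ℝ → ℝ} {x' y' t : ℝ} (hx : HasDerivAt x x' t)
    (hy : HasDerivAt y y' t) : HasDerivAt (fun s => (⟨x s, y s⟩ : ℂ)) ⟨x', y'⟩ t := by
  have h := hx.ofReal_comp.add (hy.ofReal_comp.mul_const Complex.I)
  have e : ∀ a b : ℝ, (⟨a, b⟩ : ℂ) = (a : ℂ) + (b : ℂ) * Complex.I := fun a b => by
    apply Complex.ext <;> simp
  simp only [e]
  exact h

theorem IsFlowLine.hasDerivAt {κ A B : ℝ} {γ : ℝ → ℍ} (h : IsFlowLine κ A B γ) (t : ℝ) :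
    HasDerivAt (fun s => (γ s : ℂ))
      ⟨(γ t).im * (κ + A * (γ t).im), (γ t).im * (B - A * (γ t).re)⟩ t :=
  hasDerivAt_mk (h.re_deriv t) (h.im_deriv t)

/-- Bootstrapping: the derivatives are polynomials in `x` and `y`, so each order of smoothness
yields the next. -/
theorem contDiff_of_polynomial_system {κ A B : ℝ} {x y : ℝ → ℝ}
    (hx : ∀ t, HasDerivAt x (y t * (κ + A * y t)) t)
    (hy : ∀ t, HasDerivAt y (y t * (B - A * x t)) t) : ContDiff ℝ ∞ x ∧ ContDiff ℝ ∞ y := by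
  have key : ∀ n : ℕ, ContDiff ℝ n x ∧ ContDiff ℝ n y := by
    intro n
    induction n with
    | zero =>
      exact ⟨contDiff_zero.2 (continuous_iff_continuousAt.2 fun t => (hx t).continuousAt),
        contDiff_zero.2 (continuous_iff_continuousAt.2 fun t => (hy t).continuousAt)⟩
    | succ n ih =>
      obtain ⟨ix, iy⟩ := ih
      have ex : deriv x = fun t => y t * (κ + A * y t) := funext fun t => (hx t).deriv
      have ey : deriv y = fun t => y t * (B - A * x t) := funext fun t => (hy t).deriv
      constructor
      · push_cast
        rw [contDiff_succ_iff_deriv, ex]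
        exact ⟨fun t => (hx t).differentiableAt, by simp, by fun_prop⟩
      · push_cast
        rw [contDiff_succ_iff_deriv, ey]
        exact ⟨fun t => (hy t).differentiableAt, by simp, by fun_prop⟩
  exact ⟨contDiff_infty.2 fun n => (key n).1, contDiff_infty.2 fun n => (key n).2⟩

theorem IsFlowLine.isConstantCurvatureCurve {κ A B : ℝ} {γ : ℝ → ℍ} (h : IsFlowLine κ A B γ) :
    IsConstantCurvatureCurve (Set.range γ) := by
  have hv : velocity γ =
      fun t => ⟨(γ t).im * (κ + A * (γ t).im), (γ t).im * (B - A * (γ t).re)⟩ :=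
    funext fun t => (h.hasDerivAt t).deriv
  have ha := fun t => (hasDerivAt_mk
      ((h.im_deriv t).mul (((h.im_deriv t).const_mul A).const_add κ))
      ((h.im_deriv t).mul (((h.re_deriv t).const_mul A).const_sub B))).deriv
  simp only [Pi.mul_apply, ← hv] at ha
  refine ⟨γ, ⟨?_, ?_⟩, ⟨κ, ?_⟩, rfl⟩
  · obtain ⟨hx, hy⟩ := contDiff_of_polynomial_system h.re_deriv h.im_deriv
    have : (fun t => (γ t : ℂ)) = fun t => (((γ t).re : ℂ) + ((γ t).im : ℂ) * Complex.I) :=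
      funext fun t => (re_add_im (γ t)).symm
    rw [this]
    exact (Complex.ofRealCLM.contDiff.comp hx).add
      ((Complex.ofRealCLM.contDiff.comp hy).mul contDiff_const)
  · intro t
    have := h.unit t
    have hy := (γ t).im_ne_zero
    rw [metricInner, hv]
    simp only [Complex.mul_re, Complex.conj_re, Complex.conj_im]
    field_simp
    linear_combination this
  · intro t
    have := h.unit t
    have hy := (γ t).im_ne_zero
    simp only [geodesicCurvature, metricInner, covariantAcceleration, ha t]
    rw [hv]
    simp only [Complex.mul_re, Complex.mul_im, Complex.conj_re, Complex.conj_im, Complex.I_re,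
      Complex.I_im, map_mul, Complex.conj_I, Complex.neg_re, Complex.neg_im]
    generalize (γ t).im = y at *
    generalize (γ t).re = x at *
    field_simp
    linear_combination κ * this

/-- Unit-speed curves of constant curvature are flow lines. -/
theorem IsUnitSpeedCurve.isFlowLine {γ : ℝ → ℍ} (h : IsUnitSpeedCurve γ) {κ : ℝ}
    (hκ : ∀ t, geodesicCurvature γ t = κ) : ∃ A B, IsFlowLine κ A B γ := by
  have hs := h.smooth
  have hs' : ContDiff ℝ ∞ (velocity γ) := (contDiff_infty_iff_deriv.1 hs).2
  have d0 : ∀ t, HasDerivAt (fun s => (γ s : ℂ)) (velocity γ t) t := fun t =>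
    ((hs.differentiable (by simp)) t).hasDerivAt
  have d1 : ∀ t, HasDerivAt (velocity γ) (deriv (velocity γ) t) t := fun t =>
    ((hs'.differentiable (by simp)) t).hasDerivAt
  set v := velocity γ with hv
  set a := deriv v with ha
  have dx : ∀ t, HasDerivAt (fun s => (γ s).re) (v t).re t := fun t =>
    (Complex.reCLM.hasFDerivAt.comp_hasDerivAt t (d0 t))
  have dy : ∀ t, HasDerivAt (fun s => (γ s).im) (v t).im t := fun t =>
    (Complex.imCLM.hasFDerivAt.comp_hasDerivAt t (d0 t))
  have dv1 : ∀ t, HasDerivAt (fun s => (v s).re) (a t).re t := fun t =>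
    (Complex.reCLM.hasFDerivAt.comp_hasDerivAt t (d1 t))
  have dv2 : ∀ t, HasDerivAt (fun s => (v s).im) (a t).im t := fun t =>
    (Complex.imCLM.hasFDerivAt.comp_hasDerivAt t (d1 t))
  have hu : ∀ t, (v t).re ^ 2 + (v t).im ^ 2 = (γ t).im ^ 2 := fun t => by
    have := h.unit_speed t
    have hy := (γ t).im_ne_zero
    rw [metricInner, ← hv, div_eq_one_iff_eq (pow_ne_zero 2 hy)] at this
    rw [← this]; simp; ring
  have hu' : ∀ t, (v t).re * (a t).re + (v t).im * (a t).im = (γ t).im * (v t).im := fun t => by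
    have e1 := ((dv1 t).pow 2).add ((dv2 t).pow 2)
    have e2 := (dy t).pow 2
    have e3 : (fun s => (v s).re) ^ 2 + (fun s => (v s).im) ^ 2 = (fun s => (γ s).im) ^ 2 :=
      funext hu
    rw [e3] at e1
    have := e1.unique e2
    norm_num at this
    linarith
  have hc : ∀ t, -(v t).im * ((a t).re - 2 * (v t).re * (v t).im / (γ t).im) +
      (v t).re * ((a t).im + ((v t).re ^ 2 - (v t).im ^ 2) / (γ t).im) = κ * (γ t).im ^ 2 := by
    intro t
    have := hκ t
    have hy := (γ t).im_ne_zero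
    rw [geodesicCurvature, metricInner, covariantAcceleration, ← hv, ← ha,
      div_eq_iff (pow_ne_zero 2 hy)] at this
    rw [← this]
    simp
    ring
  -- the acceleration is determined by its components along the velocity and the normal
  have a1 : ∀ t, (a t).re = 2 * (v t).re * (v t).im / (γ t).im - κ * (v t).im := fun t => by
    have hy := (γ t).im_ne_zero
    have h1 := hu t; have h2 := hu' t; have h3 := hc t
    generalize (γ t).im = y at *
    generalize (v t).re = p at *
    generalize (v t).im = q at *
    generalize (a t).re = b at *
    generalize (a t).im = c at *
    have h3' : -q * (b * y - 2 * p * q) + p * (c * y + (p ^ 2 - q ^ 2)) = κ * y ^ 3 := by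
      field_simp at h3
      linear_combination h3
    have hy2 := pow_ne_zero 2 hy
    field_simp
    refine mul_left_cancel₀ hy2 ?_
    linear_combination p * y * h2 - q * h3' + (p * q - y * b) * h1
  have a2 : ∀ t, (a t).im = ((v t).im ^ 2 - (v t).re ^ 2) / (γ t).im + κ * (v t).re := fun t => by
    have hy := (γ t).im_ne_zero
    have h1 := hu t; have h2 := hu' t; have h3 := hc t
    generalize (γ t).im = y at *
    generalize (v t).re = p at *
    generalize (v t).im = q at *
    generalize (a t).re = b at *
    generalize (a t).im = c at *
    have h3' : -q * (b * y - 2 * p * q) + p * (c * y + (p ^ 2 - q ^ 2)) = κ * y ^ 3 := by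
      field_simp at h3
      linear_combination h3
    have hy2 := pow_ne_zero 2 hy
    field_simp
    refine mul_left_cancel₀ hy2 ?_
    linear_combination q * y * h2 + p * h3' - (p ^ 2 + y * c) * h1
  -- The two first integrals. The Euclidean unit tangent is `v / y`, and `-A` is the signed
  -- Euclidean curvature of the trajectory. Its constancy says that the trajectory lies on a
  -- Euclidean circle or line.
  have hA : ∀ t, HasDerivAt (fun s => ((v s).re / (γ s).im - κ) / (γ s).im) 0 t := fun t => by
    have hy := (γ t).im_ne_zero
    refine ((((dv1 t).div (dy t) hy).sub_const κ).div (dy t) hy).congr_deriv ?_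
    simp only [Pi.div_apply]
    rw [a1]
    field_simp
    ring
  have hA' : ∀ t, ((v t).re / (γ t).im - κ) / (γ t).im = ((v 0).re / (γ 0).im - κ) / (γ 0).im :=
    fun t => is_const_of_deriv_eq_zero (fun t => (hA t).differentiableAt)
      (fun t => (hA t).deriv) t 0
  set A := ((v 0).re / (γ 0).im - κ) / (γ 0).im
  have hB : ∀ t, HasDerivAt (fun s => (v s).im / (γ s).im + A * (γ s).re) 0 t := fun t => by
    have hy := (γ t).im_ne_zero
    refine (((dv2 t).div (dy t) hy).add ((dx t).const_mul A)).congr_deriv ?_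
    rw [a2, ← hA' t]
    field_simp
    ring
  have hB' : ∀ t, (v t).im / (γ t).im + A * (γ t).re = (v 0).im / (γ 0).im + A * (γ 0).re :=
    fun t => is_const_of_deriv_eq_zero (fun t => (hB t).differentiableAt)
      (fun t => (hB t).deriv) t 0
  refine ⟨A, (v 0).im / (γ 0).im + A * (γ 0).re, ?_, ?_, ?_⟩
  · intro t
    have hy := (γ t).im_ne_zero
    convert dx t using 1
    rw [← hA' t]
    field_simp
    ring
  · intro t
    have hy := (γ t).im_ne_zero
    convert dy t using 1
    rw [← hB' t]
    field_simp
    ring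
  · intro t
    have hy := (γ t).im_ne_zero
    rw [← hB' t]
    have : κ + A * (γ t).im = (v t).re / (γ t).im := by
      rw [← hA' t]; field_simp; ring
    rw [this]
    have := hu t
    field_simp
    linear_combination this

-- Uniqueness for the system: its right-hand side extends to a polynomial, hence `C¹`, vector field
-- on all of `ℂ`.
open scoped Manifold in
theorem IsFlowLine.eq_of_apply_eq {κ A B : ℝ} {γ δ : ℝ → ℍ} (hγ : IsFlowLine κ A B γ)
    (hδ : IsFlowLine κ A B δ) {t₀ : ℝ} (h : γ t₀ = δ t₀) : γ = δ := by
  let v : ℂ → ℂ := fun z => ((z.im * (κ + A * z.im) : ℝ) : ℂ) +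
    ((z.im * (B - A * z.re) : ℝ) : ℂ) * Complex.I
  have hv : ContDiff ℝ 1 v := by
    have h1 : ContDiff ℝ 1 Complex.re := Complex.reCLM.contDiff
    have h2 : ContDiff ℝ 1 Complex.im := Complex.imCLM.contDiff
    have h3 : ContDiff ℝ 1 Complex.ofReal := Complex.ofRealCLM.contDiff
    exact (h3.comp (h2.mul (contDiff_const.add (contDiff_const.mul h2)))).add
      ((h3.comp (h2.mul (contDiff_const.sub (contDiff_const.mul h1)))).mul contDiff_const)
  have hI : ∀ {γ : ℝ → ℍ}, IsFlowLine κ A B γ →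
      IsMIntegralCurve (I := 𝓘(ℝ, ℂ)) (fun s => (γ s : ℂ)) v := by
    intro γ h t
    have := (h.hasDerivAt t).hasFDerivAt.hasMFDerivAt
    have e : v (γ t : ℂ) =
        ⟨(γ t).im * (κ + A * (γ t).im), (γ t).im * (B - A * (γ t).re)⟩ := by
      apply Complex.ext <;> simp [v]
    rw [← e] at this
    exact this
  have := isMIntegralCurve_Ioo_eq_of_contMDiff_boundaryless (I := 𝓘(ℝ, ℂ)) (v := v) (t₀ := t₀)
    (contMDiff_vectorSpace_iff_contDiff.2 hv) (hI hγ) (hI hδ) (by rw [h])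
  funext t
  exact UpperHalfPlane.ext (congrFun this t)

/-! ### Explicit solutions and generalized circles -/

/-- The trace on the upper half-plane of the generalized circle through `p` with equation
`a |w|² + b Re w + c Im w = 0` in the variable `w = z - p`. -/
def curveAt (p : ℍ) (a b c : ℝ) : Set ℍ :=
  {z | a * ((z.re - p.re) ^ 2 + (z.im - p.im) ^ 2) + b * (z.re - p.re) + c * (z.im - p.im) = 0}

theorem mem_curveAt {p z : ℍ} {a b c : ℝ} : z ∈ curveAt p a b c ↔
    a * ((z.re - p.re) ^ 2 + (z.im - p.im) ^ 2) + b * (z.re - p.re) + c * (z.im - p.im) = 0 :=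
  Iff.rfl

theorem self_mem_curveAt (p : ℍ) (a b c : ℝ) : p ∈ curveAt p a b c := by
  simp [mem_curveAt]

theorem curveAt_smul {k : ℝ} (hk : k ≠ 0) (p : ℍ) (a b c : ℝ) :
    curveAt p (k * a) (k * b) (k * c) = curveAt p a b c := by
  ext z
  rw [mem_curveAt, mem_curveAt]
  exact ⟨fun h => mul_left_cancel₀ hk (by linear_combination h),
    fun h => by linear_combination k * h⟩

theorem exists_cos_sin_eq {c s : ℝ} (h : c ^ 2 + s ^ 2 = 1) :
    ∃ θ : ℝ, Real.cos θ = c ∧ Real.sin θ = s := by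
  have hn : ‖(⟨c, s⟩ : ℂ)‖ = 1 := by
    rw [Complex.norm_def, Complex.normSq_mk, ← sq, ← sq, h, Real.sqrt_one]
  refine ⟨Complex.arg ⟨c, s⟩, ?_, ?_⟩
  · rw [Complex.cos_arg (by rw [← norm_ne_zero_iff, hn]; norm_num), hn]; simp
  · rw [Complex.sin_arg, hn]; simp

/-- For `κ < 1` the equation `θ' = κ - cos θ` has a global solution along which
`(cos θ, sin θ)` runs through the whole arc `κ < cos θ` of the unit circle. -/
theorem exists_arc {κ : ℝ} (hκ : κ < 1) : ∃ u v : ℝ → ℝ,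
    (∀ t, HasDerivAt u (v t * (u t - κ)) t) ∧ (∀ t, HasDerivAt v (-u t * (u t - κ)) t) ∧
    (∀ t, u t ^ 2 + v t ^ 2 = 1) ∧ (∀ t, κ < u t) ∧
    ∀ c s : ℝ, c ^ 2 + s ^ 2 = 1 → κ < c → ∃ t, u t = c ∧ v t = s := by
  -- The reciprocal `w = 1 / (u - κ)` satisfies the linear equation `w'' = (1 - κ ^ 2) * w - κ`.
  -- This explains the trigonometric, quadratic and hyperbolic formulas, which correspond to
  -- circles, horocycles and hypercycles or geodesics.
  rcases lt_trichotomy κ (-1) with h | h | h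
  · have hpos : 0 < κ ^ 2 - 1 := by nlinarith
    obtain ⟨m, hm, hm2⟩ : ∃ m : ℝ, 0 < m ∧ m ^ 2 = κ ^ 2 - 1 :=
      ⟨√(κ ^ 2 - 1), Real.sqrt_pos.2 hpos, Real.sq_sqrt hpos.le⟩
    have hd : ∀ t, 0 < Real.cos t - κ := fun t => by linarith [Real.neg_one_le_cos t]
    have dc : ∀ t, HasDerivAt (fun t => Real.cos (m * t) - κ) (-m * Real.sin (m * t)) t := fun t =>
      ((((hasDerivAt_id t).const_mul m).cos).sub_const κ).congr_deriv (by simp; ring)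
    have ds : ∀ t, HasDerivAt (fun t => Real.sin (m * t)) (m * Real.cos (m * t)) t := fun t =>
      (((hasDerivAt_id t).const_mul m).sin).congr_deriv (by simp; ring)
    refine ⟨fun t => κ + m ^ 2 / (Real.cos (m * t) - κ),
      fun t => m * Real.sin (m * t) / (Real.cos (m * t) - κ), fun t => ?_, fun t => ?_,
      fun t => ?_, fun t => ?_, fun c s hcs hc => ?_⟩
    · have := (hd (m * t)).ne'
      refine (((hasDerivAt_const t (m ^ 2)).div (dc t) this).const_add κ).congr_deriv ?_
      field_simp
      ring
    · have := (hd (m * t)).ne'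
      refine (((ds t).const_mul m).div (dc t) this).congr_deriv ?_
      have h1 := Real.sin_sq_add_cos_sq (m * t)
      field_simp
      linear_combination m ^ 2 * h1 + m ^ 2 * hm2
    · have := (hd (m * t)).ne'
      have h1 := Real.sin_sq_add_cos_sq (m * t)
      field_simp
      linear_combination (κ ^ 2 - 1) * h1 + (Real.sin (m * t) ^ 2 +
        2 * κ * (Real.cos (m * t) - κ) + m ^ 2 + κ ^ 2 - 1) * hm2
    · have := div_pos (pow_pos hm 2) (hd (m * t))
      linarith
    · have hc' : 0 < c - κ := sub_pos.2 hc
      obtain ⟨θ, h1, h2⟩ := exists_cos_sin_eq (c := κ + m ^ 2 / (c - κ)) (s := m * s / (c - κ)) (by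
        field_simp
        linear_combination (κ ^ 2 - 1) * hcs + (s ^ 2 + 2 * κ * (c - κ) + m ^ 2 + κ ^ 2 - 1) * hm2)
      refine ⟨θ / m, ?_, ?_⟩
      · simp only [mul_div_cancel₀ _ hm.ne', h1]
        field_simp
        ring
      · simp only [mul_div_cancel₀ _ hm.ne', h1, h2]
        field_simp
        ring
  · subst h
    have hd : ∀ t : ℝ, 0 < 1 + t ^ 2 := fun t => by positivity
    have dd : ∀ t : ℝ, HasDerivAt (fun t : ℝ => 1 + t ^ 2) (2 * t) t := fun t =>
      (((hasDerivAt_id t).pow 2).const_add 1).congr_deriv (by simp)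
    refine ⟨fun t => -1 + 2 / (1 + t ^ 2), fun t => -2 * t / (1 + t ^ 2), fun t => ?_, fun t => ?_,
      fun t => ?_, fun t => ?_, fun c s hcs hc => ?_⟩
    · have := (hd t).ne'
      refine (((hasDerivAt_const t (2 : ℝ)).div (dd t) this).const_add (-1)).congr_deriv ?_
      field_simp
      ring
    · have := (hd t).ne'
      refine (((hasDerivAt_id t).const_mul (-2)).div (dd t) this).congr_deriv ?_
      simp only [id]
      field_simp
      ring
    · have := (hd t).ne'
      field_simp
      ring
    · have := div_pos (two_pos) (hd t)
      linarith
    · have hc' : 0 < 1 + c := by linarith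
      have e : 1 + (-s / (1 + c)) ^ 2 = 2 / (1 + c) := by
        field_simp
        linear_combination hcs
      refine ⟨-s / (1 + c), ?_, ?_⟩
      · simp only [e]
        field_simp
        ring
      · simp only [e]
        field_simp
  · have hpos : 0 < 1 - κ ^ 2 := by nlinarith
    obtain ⟨m, hm, hm2⟩ : ∃ m : ℝ, 0 < m ∧ m ^ 2 = 1 - κ ^ 2 :=
      ⟨√(1 - κ ^ 2), Real.sqrt_pos.2 hpos, Real.sq_sqrt hpos.le⟩
    have hd : ∀ t, 0 < Real.cosh t + κ := fun t => by linarith [Real.one_le_cosh t]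
    have dc : ∀ t, HasDerivAt (fun t => Real.cosh (m * t) + κ) (m * Real.sinh (m * t)) t := fun t =>
      ((((hasDerivAt_id t).const_mul m).cosh).add_const κ).congr_deriv (by simp; ring)
    have ds : ∀ t, HasDerivAt (fun t => Real.sinh (m * t)) (m * Real.cosh (m * t)) t := fun t =>
      (((hasDerivAt_id t).const_mul m).sinh).congr_deriv (by simp; ring)
    refine ⟨fun t => κ + m ^ 2 / (Real.cosh (m * t) + κ),
      fun t => -m * Real.sinh (m * t) / (Real.cosh (m * t) + κ), fun t => ?_, fun t => ?_,
      fun t => ?_, fun t => ?_, fun c s hcs hc => ?_⟩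
    · have := (hd (m * t)).ne'
      refine (((hasDerivAt_const t (m ^ 2)).div (dc t) this).const_add κ).congr_deriv ?_
      field_simp
      ring
    · have := (hd (m * t)).ne'
      refine (((ds t).const_mul (-m)).div (dc t) this).congr_deriv ?_
      have h1 := Real.cosh_sq_sub_sinh_sq (m * t)
      field_simp
      linear_combination -m ^ 2 * h1 + m ^ 2 * hm2
    · have := (hd (m * t)).ne'
      have h1 := Real.cosh_sq_sub_sinh_sq (m * t)
      field_simp
      linear_combination (κ ^ 2 - 1) * h1 + (Real.sinh (m * t) ^ 2 +
        2 * κ * (Real.cosh (m * t) + κ) + m ^ 2 + 1 - κ ^ 2) * hm2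
    · have := div_pos (pow_pos hm 2) (hd (m * t))
      linarith
    · have hc' : 0 < c - κ := sub_pos.2 hc
      obtain ⟨t, h2⟩ := Real.sinh_surjective (-m * s / (c - κ))
      have h1 : Real.cosh t = -κ + m ^ 2 / (c - κ) := by
        have hp : 0 ≤ -κ + m ^ 2 / (c - κ) := by
          rw [hm2]
          have : c ≤ 1 := by nlinarith
          have : κ ≤ (1 - κ ^ 2) / (c - κ) := by
            rw [le_div_iff₀ hc']
            nlinarith
          linarith
        rw [← abs_of_pos (Real.cosh_pos t), ← abs_of_nonneg hp, ← sq_eq_sq_iff_abs_eq_abs,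
          Real.cosh_sq, h2]
        field_simp
        linear_combination (1 - κ ^ 2) * hcs + (s ^ 2 + 2 * κ * (c - κ) - m ^ 2 + κ ^ 2 - 1) * hm2
      refine ⟨t / m, ?_, ?_⟩
      · simp only [mul_div_cancel₀ _ hm.ne', h1]
        field_simp
        ring
      · simp only [mul_div_cancel₀ _ hm.ne', h1, h2]
        field_simp
        ring

theorem IsFlowLine.comp_neg {κ A B : ℝ} {γ : ℝ → ℍ} (h : IsFlowLine κ A B γ) :
    IsFlowLine (-κ) (-A) (-B) (fun t => γ (-t)) := by
  refine ⟨fun t => ?_, fun t => ?_, fun t => ?_⟩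
  · refine ((h.re_deriv (-t)).scomp t (hasDerivAt_neg t)).congr_deriv ?_
    simp
    ring
  · refine ((h.im_deriv (-t)).scomp t (hasDerivAt_neg t)).congr_deriv ?_
    simp
    ring
  · linear_combination h.unit (-t)

theorem IsFlowLine.comp_add {κ A B : ℝ} {γ : ℝ → ℍ} (h : IsFlowLine κ A B γ) (b : ℝ) :
    IsFlowLine κ A B (fun t => γ (t + b)) :=
  ⟨fun t => (h.re_deriv (t + b)).comp_add_const t b,
    fun t => (h.im_deriv (t + b)).comp_add_const t b, fun t => h.unit (t + b)⟩

/-- The coordinates are recovered from the unit tangent `(U, V)` by solving `U = κ + A * y` and `V =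
B - A * x`. The condition `κ < U` is exactly `0 < y`, so covering the whole arc of directions covers
the whole trace. -/
theorem exists_flowLine_of_pos (p : ℍ) {A u v : ℝ} (hA : 0 < A) (huv : u ^ 2 + v ^ 2 = 1) :
    ∃ γ, IsFlowLine (u - A * p.im) A (v + A * p.re) γ ∧
      Set.range γ = curveAt p A (-2 * v) (2 * u) := by
  have hκ : u - A * p.im < 1 := by
    have := mul_pos hA p.im_pos
    nlinarith
  obtain ⟨U, V, hU, hV, hUV, hpos, hsurj⟩ := exists_arc hκ
  have hp : ∀ t, 0 < (U t - (u - A * p.im)) / A := fun t => div_pos (sub_pos.2 (hpos t)) hA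
  let γ : ℝ → ℍ := fun t => ⟨⟨(v + A * p.re - V t) / A, (U t - (u - A * p.im)) / A⟩, hp t⟩
  have hre : ∀ t, (γ t).re = (v + A * p.re - V t) / A := fun t => rfl
  have him : ∀ t, (γ t).im = (U t - (u - A * p.im)) / A := fun t => rfl
  have h1 : ∀ t, u - A * p.im + A * (γ t).im = U t := fun t => by rw [him]; field_simp; ring
  have h2 : ∀ t, v + A * p.re - A * (γ t).re = V t := fun t => by rw [hre]; field_simp; ring
  refine ⟨γ, ⟨fun t => ?_, fun t => ?_, fun t => ?_⟩, ?_⟩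
  · rw [h1, him]
    refine (((hV t).const_sub (v + A * p.re)).div_const A).congr_deriv ?_
    ring
  · rw [h2, him]
    refine (((hU t).sub_const (u - A * p.im)).div_const A).congr_deriv ?_
    ring
  · rw [h1, h2, hUV]
  · ext z
    rw [mem_curveAt]
    constructor
    · rintro ⟨t, rfl⟩
      have := hUV t
      rw [← h1, ← h2] at this
      refine mul_left_cancel₀ hA.ne' ?_
      linear_combination this - huv
    · intro hz
      obtain ⟨t, ht1, ht2⟩ := hsurj (u - A * p.im + A * z.im) (v + A * p.re - A * z.re)
        (by linear_combination A * hz + huv) (by nlinarith [z.im_pos])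
      refine ⟨t, ext_re_im ?_ ?_⟩
      · rw [hre, ht2]; field_simp; ring
      · rw [him, ht1]; field_simp; ring

theorem exists_flowLine_of_zero (p : ℍ) {u v : ℝ} (huv : u ^ 2 + v ^ 2 = 1) :
    ∃ γ, IsFlowLine (u - 0 * p.im) 0 (v + 0 * p.re) γ ∧
      Set.range γ = curveAt p 0 (-2 * v) (2 * u) := by
  by_cases hv : v = 0
  · subst hv
    have hu : u ≠ 0 := by rintro rfl; norm_num at huv
    have hy := p.im_ne_zero
    let γ : ℝ → ℍ := fun t => ⟨⟨p.im * u * t, p.im⟩, p.im_pos⟩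
    have hre : ∀ t, (γ t).re = p.im * u * t := fun t => rfl
    have him : ∀ t, (γ t).im = p.im := fun t => rfl
    refine ⟨γ, ⟨fun t => ?_, fun t => ?_, fun t => ?_⟩, ?_⟩
    · rw [him]
      refine ((hasDerivAt_id t).const_mul (p.im * u)).congr_deriv ?_
      ring
    · refine (hasDerivAt_const t p.im).congr_deriv ?_
      ring
    · linear_combination huv
    · ext z
      rw [mem_curveAt]
      constructor
      · rintro ⟨t, rfl⟩
        rw [him]
        ring
      · intro h
        have hz : z.im = p.im := by
          have : u * (z.im - p.im) = 0 := by linear_combination h / 2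
          rcases mul_eq_zero.1 this with h | h
          · exact absurd h hu
          · linarith
        refine ⟨z.re / (p.im * u), ext_re_im ?_ ?_⟩
        · rw [hre]; field_simp
        · rw [him, hz]
  · have hd : ∀ t, HasDerivAt (fun t => Real.exp (v * t)) (v * Real.exp (v * t)) t := fun t =>
      ((hasDerivAt_id t).const_mul v).exp.congr_deriv (by simp; ring)
    let γ : ℝ → ℍ := fun t =>
      ⟨⟨p.re + u / v * (Real.exp (v * t) - p.im), Real.exp (v * t)⟩, Real.exp_pos _⟩
    have hre : ∀ t, (γ t).re = p.re + u / v * (Real.exp (v * t) - p.im) := fun t => rfl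
    have him : ∀ t, (γ t).im = Real.exp (v * t) := fun t => rfl
    refine ⟨γ, ⟨fun t => ?_, fun t => ?_, fun t => ?_⟩, ?_⟩
    · rw [him]
      refine ((((hd t).sub_const p.im).const_mul (u / v)).const_add p.re).congr_deriv ?_
      field_simp
      ring
    · rw [him]
      refine (hd t).congr_deriv ?_
      ring
    · linear_combination huv
    · ext z
      rw [mem_curveAt]
      constructor
      · rintro ⟨t, rfl⟩
        rw [him, hre]
        field_simp
        ring
      · intro h
        have e : Real.exp (v * (Real.log z.im / v)) = z.im := by
          rw [mul_div_cancel₀ _ hv, Real.exp_log z.im_pos]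
        refine ⟨Real.log z.im / v, ext_re_im ?_ ?_⟩
        · rw [hre, e]
          field_simp
          linear_combination h / 2
        · rw [him, e]

theorem exists_flowLine (p : ℍ) (A : ℝ) {u v : ℝ} (huv : u ^ 2 + v ^ 2 = 1) :
    ∃ γ, IsFlowLine (u - A * p.im) A (v + A * p.re) γ ∧
      Set.range γ = curveAt p A (-2 * v) (2 * u) := by
  rcases lt_trichotomy A 0 with hA | rfl | hA
  · obtain ⟨γ, hγ, hr⟩ := exists_flowLine_of_pos p (A := -A) (u := -u) (v := -v) (by linarith)
      (by linear_combination huv)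
    refine ⟨fun t => γ (-t), ?_, ?_⟩
    · convert hγ.comp_neg using 1 <;> ring
    · rw [← curveAt_smul (k := -1) (by norm_num) p A]
      convert hr using 1
      · exact (Equiv.neg ℝ).surjective.range_comp γ
      · congr 1 <;> ring
  · exact exists_flowLine_of_zero p huv
  · exact exists_flowLine_of_pos p hA huv

/-- The constant curvature curves through `p` are the traces of the generalized circles
through `p`. -/
theorem isConstantCurvatureCurve_iff {p : ℍ} {C : Set ℍ} (hp : p ∈ C) :
    IsConstantCurvatureCurve C ↔ ∃ a b c : ℝ, (b ≠ 0 ∨ c ≠ 0) ∧ C = curveAt p a b c := by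
  constructor
  · rintro ⟨γ, hγ, ⟨κ, hκ⟩, rfl⟩
    obtain ⟨A, B, h⟩ := hγ.isFlowLine hκ
    obtain ⟨t₀, rfl⟩ := hp
    have hu := h.unit t₀
    refine ⟨A, -2 * (B - A * (γ t₀).re), 2 * (κ + A * (γ t₀).im), ?_, ?_⟩
    · by_contra! h0
      have h1 : B - A * (γ t₀).re = 0 := by linarith [h0.1]
      have h2 : κ + A * (γ t₀).im = 0 := by linarith [h0.2]
      rw [h1, h2] at hu
      norm_num at hu
    · obtain ⟨δ, hδ, hr⟩ := exists_flowLine (γ t₀) A hu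
      rw [← hr]
      obtain ⟨s, hs⟩ : γ t₀ ∈ Set.range δ := by rw [hr]; exact self_mem_curveAt _ _ _ _
      have hδ' : IsFlowLine κ A B δ := by convert hδ using 1 <;> ring
      -- The given curve and the explicit one solve the same system and share a point, so they
      -- differ by a time shift and have the same image.
      have := h.eq_of_apply_eq (hδ'.comp_add (s - t₀)) (t₀ := t₀) (by simp [hs])
      rw [this]
      exact (Equiv.addRight (s - t₀)).surjective.range_comp δ
  · rintro ⟨a, b, c, hbc, rfl⟩
    have hpos : 0 < b ^ 2 + c ^ 2 := by
      rcases hbc with h | h <;> positivity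
    set k := √(b ^ 2 + c ^ 2) with hk
    have hk0 : 0 < k := Real.sqrt_pos.2 hpos
    have hk2 : k ^ 2 = b ^ 2 + c ^ 2 := Real.sq_sqrt hpos.le
    obtain ⟨γ, hγ, hr⟩ := exists_flowLine p (2 * a / k) (u := c / k) (v := -b / k) (by
      field_simp; linarith)
    rw [← curveAt_smul (k := 2 / k) (by positivity) p a b c]
    have e : curveAt p (2 / k * a) (2 / k * b) (2 / k * c) = Set.range γ := by
      rw [hr]; congr 1 <;> ring
    rw [e]
    exact hγ.isConstantCurvatureCurve

theorem IsConstantCurvatureCurve.nonempty {C : Set ℍ} (h : IsConstantCurvatureCurve C) :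
    C.Nonempty := by
  obtain ⟨γ, -, -, rfl⟩ := h
  exact Set.range_nonempty γ

theorem isConstantCurvatureCurve_curveAt (p : ℍ) (a : ℝ) {b c : ℝ} (h : b ≠ 0 ∨ c ≠ 0) :
    IsConstantCurvatureCurve (curveAt p a b c) :=
  (isConstantCurvatureCurve_iff (self_mem_curveAt p a b c)).2 ⟨a, b, c, h, rfl⟩

/-! ### Three points determine a curve -/

theorem sq_add_sq_pos_of_ne {p q : ℍ} (h : p ≠ q) :
    0 < (q.re - p.re) ^ 2 + (q.im - p.im) ^ 2 := by
  by_contra! h0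
  have h1 : (q.re - p.re) ^ 2 = 0 := by nlinarith [sq_nonneg (q.re - p.re), sq_nonneg (q.im - p.im)]
  have h2 : (q.im - p.im) ^ 2 = 0 := by nlinarith [sq_nonneg (q.re - p.re), sq_nonneg (q.im - p.im)]
  exact h (ext_re_im (by linarith [pow_eq_zero_iff (two_ne_zero) |>.1 h1])
    (by linarith [pow_eq_zero_iff (two_ne_zero) |>.1 h2]))

/-- Dividing the equation of a curve through `p` by `|w|²` turns it into the equation of a line in
the coordinates `w / |w|²`. The images of `q` and `r` under this inversion are distinct, so they
determine that line. -/
theorem existsUnique_curve {p q r : ℍ} (hpq : p ≠ q) (hpr : p ≠ r) (hqr : q ≠ r) :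
    ∃! C, IsConstantCurvatureCurve C ∧ p ∈ C ∧ q ∈ C ∧ r ∈ C := by
  have hn1 := sq_add_sq_pos_of_ne hpq
  have hn2 := sq_add_sq_pos_of_ne hpr
  set x1 := q.re - p.re with hx1
  set y1 := q.im - p.im with hy1
  set x2 := r.re - p.re with hx2
  set y2 := r.im - p.im with hy2
  set n1 := x1 ^ 2 + y1 ^ 2 with hn1'
  set n2 := x2 ^ 2 + y2 ^ 2 with hn2'
  -- coordinates after an inversion centred at `p`
  set u := x1 / n1 - x2 / n2 with hu
  set v := y1 / n1 - y2 / n2 with hv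
  have huv : 0 < u ^ 2 + v ^ 2 := by
    by_contra! h0
    have e1 : u = 0 := by nlinarith [sq_nonneg u, sq_nonneg v]
    have e2 : v = 0 := by nlinarith [sq_nonneg u, sq_nonneg v]
    have f1 : x1 / n1 = x2 / n2 := by linarith
    have f2 : y1 / n1 = y2 / n2 := by linarith
    have g1 : (x1 / n1) ^ 2 + (y1 / n1) ^ 2 = 1 / n1 := by
      field_simp; rw [hn1']
    have g2 : (x2 / n2) ^ 2 + (y2 / n2) ^ 2 = 1 / n2 := by
      field_simp; rw [hn2']
    have hn : n1 = n2 := by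
      rw [f1, f2, g2] at g1
      field_simp at g1
      exact g1
    rw [hn] at f1 f2
    have := hn2.ne'
    field_simp at f1 f2
    exact hqr (ext_re_im (by linarith) (by linarith))
  have hbc : -v ≠ 0 ∨ u ≠ 0 := by
    by_contra! h0
    have : v = 0 := by linarith [h0.1]
    rw [this, h0.2] at huv
    norm_num at huv
  refine ⟨curveAt p ((x1 * y2 - x2 * y1) / (n1 * n2) * (-1)) (-v) u,
    ⟨isConstantCurvatureCurve_curveAt p _ hbc, self_mem_curveAt _ _ _ _, ?_, ?_⟩, ?_⟩
  · rw [mem_curveAt, ← hx1, ← hy1, ← hn1', hu, hv]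
    field_simp
    ring
  · rw [mem_curveAt, ← hx2, ← hy2, ← hn2', hu, hv]
    field_simp
    ring
  · rintro D ⟨hD, hpD, hqD, hrD⟩
    obtain ⟨a, b, c, hbc', rfl⟩ := (isConstantCurvatureCurve_iff hpD).1 hD
    rw [mem_curveAt, ← hx1, ← hy1, ← hn1'] at hqD
    rw [mem_curveAt, ← hx2, ← hy2, ← hn2'] at hrD
    have k1 : a + b * (x1 / n1) + c * (y1 / n1) = 0 := by
      field_simp; linarith
    have k2 : a + b * (x2 / n2) + c * (y2 / n2) = 0 := by
      field_simp; linarith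
    have k3 : b * u + c * v = 0 := by rw [hu, hv]; linear_combination k1 - k2
    have eb : b = (c * u - b * v) / (u ^ 2 + v ^ 2) * (-v) := by
      field_simp; linear_combination u * k3
    have ec : c = (c * u - b * v) / (u ^ 2 + v ^ 2) * u := by
      field_simp; linear_combination v * k3
    set k := (c * u - b * v) / (u ^ 2 + v ^ 2) with hk
    have hk0 : k ≠ 0 := by
      intro h0
      rw [h0, zero_mul] at eb ec
      rcases hbc' with h | h
      · exact h eb
      · exact h ec
    have ea : a = k * ((x1 * y2 - x2 * y1) / (n1 * n2) * (-1)) := by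
      have : a = -(b * (x1 / n1) + c * (y1 / n1)) := by linarith
      rw [this, eb, ec, hu, hv]
      field_simp
      ring
    rw [ea]
    nth_rw 1 [eb]
    nth_rw 1 [ec]
    exact curveAt_smul hk0 _ _ _ _

/-! ### Curve-preserving bijections -/

/-- A bijection of the hyperbolic plane that maps constant curvature curves to constant
curvature curves. -/
def PreservesCurves (f : ℍ ≃ ℍ) : Prop :=
  ∀ C, IsConstantCurvatureCurve C → IsConstantCurvatureCurve (f '' C)

theorem IsConstantCurvatureCurve.infinite {C : Set ℍ} (h : IsConstantCurvatureCurve C) :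
    C.Infinite := by
  obtain ⟨γ, hγ, -, rfl⟩ := h
  have hc : Continuous γ := isOpenEmbedding_coe.isEmbedding.continuous_iff.2 hγ.smooth.continuous
  refine (isPreconnected_range hc).infinite_of_nontrivial ?_
  rw [← Set.not_subsingleton_iff]
  intro hs
  have hconst : (fun s : ℝ => (γ s : ℂ)) = fun _ => (γ 0 : ℂ) :=
    funext fun s => by rw [hs (Set.mem_range_self s) (Set.mem_range_self 0)]
  have := hγ.unit_speed 0
  simp [metricInner, velocity, hconst] at this

theorem IsConstantCurvatureCurve.exists_three {C : Set ℍ} (h : IsConstantCurvatureCurve C) :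
    ∃ p ∈ C, ∃ q ∈ C, ∃ r ∈ C, p ≠ q ∧ p ≠ r ∧ q ≠ r := by
  classical
  obtain ⟨t, ht, hcard⟩ := h.infinite.exists_subset_card_eq 3
  obtain ⟨p, q, r, hpq, hpr, hqr, rfl⟩ := Finset.card_eq_three.1 hcard
  exact ⟨p, ht (by simp), q, ht (by simp), r, ht (by simp), hpq, hpr, hqr⟩

theorem IsConstantCurvatureCurve.eq_of_mem {C D : Set ℍ} (hC : IsConstantCurvatureCurve C)
    (hD : IsConstantCurvatureCurve D) {p q r : ℍ} (hpq : p ≠ q) (hpr : p ≠ r) (hqr : q ≠ r)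
    (h1 : p ∈ C) (h2 : q ∈ C) (h3 : r ∈ C) (h4 : p ∈ D) (h5 : q ∈ D) (h6 : r ∈ D) : C = D :=
  (existsUnique_curve hpq hpr hqr).unique ⟨hC, h1, h2, h3⟩ ⟨hD, h4, h5, h6⟩

/-- Three points of `D` pull back to three distinct points, which lie on a curve. The image of that
curve shares three points with `D`, hence equals it. -/
theorem PreservesCurves.symm {f : ℍ ≃ ℍ} (h : PreservesCurves f) : PreservesCurves f.symm := by
  intro D hD
  obtain ⟨p, hp, q, hq, r, hr, hpq, hpr, hqr⟩ := hD.exists_three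
  have e1 := f.symm.injective.ne hpq
  have e2 := f.symm.injective.ne hpr
  have e3 := f.symm.injective.ne hqr
  obtain ⟨C, ⟨hC, h1, h2, h3⟩, -⟩ := existsUnique_curve e1 e2 e3
  have : f '' C = D := (h C hC).eq_of_mem hD hpq hpr hqr ⟨_, h1, f.apply_symm_apply p⟩
    ⟨_, h2, f.apply_symm_apply q⟩ ⟨_, h3, f.apply_symm_apply r⟩ hp hq hr
  rw [← this, f.symm_image_image]
  exact hC

theorem PreservesCurves.trans {f g : ℍ ≃ ℍ} (hf : PreservesCurves f) (hg : PreservesCurves g) :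
    PreservesCurves (f.trans g) := by
  intro C hC
  rw [Equiv.coe_trans, Set.image_comp]
  exact hg _ (hf _ hC)

/-! ### Counting touching curves -/

/-- The constant curvature curves through `q` that meet `C` in the single point `p`. -/
def touching (C : Set ℍ) (p q : ℍ) : Set (Set ℍ) :=
  {D | IsConstantCurvatureCurve D ∧ q ∈ D ∧ D ∩ C = {p}}

theorem PreservesCurves.image_mem_touching {f : ℍ ≃ ℍ} (hf : PreservesCurves f) {C D : Set ℍ}
    {p q : ℍ} (h : D ∈ touching C p q) : f '' D ∈ touching (f '' C) (f p) (f q) := by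
  refine ⟨hf _ h.1, Set.mem_image_of_mem _ h.2.1, ?_⟩
  rw [← Set.image_inter f.injective, h.2.2, Set.image_singleton]

/-- The circle with Euclidean centre `x + i y` and Euclidean radius `r`. -/
def circle (x y r : ℝ) : Set ℍ := {z | (z.re - x) ^ 2 + (z.im - y) ^ 2 = r ^ 2}

/-- The horizontal line at height `c`. -/
def horizontal (c : ℝ) : Set ℍ := {z | z.im = c}

/-- The line with equation `Re z = m Im z + k`. -/
def slanted (m k : ℝ) : Set ℍ := {z | z.re = m * z.im + k}

/-- The hyperbolic circles of positive radius. -/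
def IsCircle (C : Set ℍ) : Prop := ∃ x y r, 0 < r ∧ r < y ∧ C = circle x y r

theorem circle_eq_curveAt {x y r : ℝ} {p : ℍ} (hp : p ∈ circle x y r) :
    circle x y r = curveAt p 1 (2 * (p.re - x)) (2 * (p.im - y)) := by
  ext z
  have hp' : (p.re - x) ^ 2 + (p.im - y) ^ 2 = r ^ 2 := hp
  change (z.re - x) ^ 2 + (z.im - y) ^ 2 = r ^ 2 ↔ _
  rw [mem_curveAt]
  exact ⟨fun h => by linear_combination h - hp', fun h => by linear_combination h + hp'⟩

/-- The conclusion is tangency at `p`. Subtracting `a` times the circle equation from that of the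
curve gives their radical line through `p`, with normal `(d1, d2)`. Without tangency this line meets
the circle in a second point, which lies in the half-plane because the whole circle does. -/
theorem circle_inter_normal {x y r : ℝ} (hr : 0 < r) (hry : r < y) {p : ℍ}
    {a b c : ℝ} (h : curveAt p a b c ∩ circle x y r = {p}) :
    (p.re - x) * c = (p.im - y) * b := by
  have hp : p ∈ circle x y r := (h.symm.subset rfl).2
  have hp' : (p.re - x) ^ 2 + (p.im - y) ^ 2 = r ^ 2 := hp
  by_contra hne
  set g1 := 2 * (p.re - x) with hg1
  set g2 := 2 * (p.im - y) with hg2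
  set d1 := b - a * g1 with hd1
  set d2 := c - a * g2 with hd2
  have hJ : g1 * d2 - g2 * d1 ≠ 0 := fun h0 => hne (by
    rw [hd1, hd2, hg1, hg2] at h0
    linarith)
  have hd : 0 < d1 ^ 2 + d2 ^ 2 := by
    by_contra! h0
    have e1 : d1 = 0 := by nlinarith [sq_nonneg d1, sq_nonneg d2]
    have e2 : d2 = 0 := by nlinarith [sq_nonneg d1, sq_nonneg d2]
    exact hJ (by rw [e1, e2]; ring)
  set s := (g1 * d2 - g2 * d1) / (d1 ^ 2 + d2 ^ 2) with hs
  have hs0 : s ≠ 0 := div_ne_zero hJ hd.ne'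
  have hs' : s * (d1 ^ 2 + d2 ^ 2) = g1 * d2 - g2 * d1 := by rw [hs]; field_simp
  have hc : (p.re - s * d2 - x) ^ 2 + (p.im + s * d1 - y) ^ 2 = r ^ 2 := by
    rw [← hp']
    linear_combination s * hs'
  have hpos : 0 < p.im + s * d1 := by nlinarith [sq_nonneg (p.re - s * d2 - x)]
  let z : ℍ := ⟨⟨p.re - s * d2, p.im + s * d1⟩, hpos⟩
  have hz1 : z.re = p.re - s * d2 := rfl
  have hz2 : z.im = p.im + s * d1 := rfl
  have hz : z ∈ curveAt p a b c ∩ circle x y r := by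
    refine ⟨?_, hc⟩
    rw [mem_curveAt, hz1, hz2]
    have : c = d2 + a * g2 := by rw [hd2]; ring
    rw [this]
    have : b = d1 + a * g1 := by rw [hd1]; ring
    rw [this]
    linear_combination a * s * hs'
  rw [h, Set.mem_singleton_iff] at hz
  rw [hz] at hz1 hz2
  have e1 : d1 = 0 := (mul_eq_zero.1 (by linarith : s * d1 = 0)).resolve_left hs0
  have e2 : d2 = 0 := (mul_eq_zero.1 (by linarith : s * d2 = 0)).resolve_left hs0
  exact hJ (by rw [e1, e2]; ring)

/-- Tangency fixes `(b, c)` up to scale, and passing through `q` then fixes `a`. -/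
theorem IsCircle.touching_subsingleton {C : Set ℍ} (hC : IsCircle C) {p q : ℍ} (hq : q ∉ C) :
    (touching C p q).Subsingleton := by
  obtain ⟨x, y, r, hr, hry, rfl⟩ := hC
  suffices h : ∀ D ∈ touching (circle x y r) p q, D = curveAt p
      (-(((p.re - x) * (q.re - p.re) + (p.im - y) * (q.im - p.im)) /
        ((q.re - p.re) ^ 2 + (q.im - p.im) ^ 2))) (p.re - x) (p.im - y) by
    intro D hD E hE
    rw [h D hD, h E hE]
  rintro D ⟨hD, hqD, hi⟩
  have hp : p ∈ D ∩ circle x y r := hi.symm ▸ Set.mem_singleton p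
  have hp' : (p.re - x) ^ 2 + (p.im - y) ^ 2 = r ^ 2 := hp.2
  obtain ⟨a, b, c, hbc, rfl⟩ := (isConstantCurvatureCurve_iff hp.1).1 hD
  have hn := circle_inter_normal hr hry hi
  have hpq : p ≠ q := fun h => hq (h ▸ hp.2)
  have hpos := sq_add_sq_pos_of_ne hpq
  have hr2 : r ≠ 0 := hr.ne'
  have eb : b = (b * (p.re - x) + c * (p.im - y)) / r ^ 2 * (p.re - x) := by
    field_simp
    linear_combination -b * hp' - (p.im - y) * hn
  have ec : c = (b * (p.re - x) + c * (p.im - y)) / r ^ 2 * (p.im - y) := by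
    field_simp
    linear_combination -c * hp' + (p.re - x) * hn
  set k := (b * (p.re - x) + c * (p.im - y)) / r ^ 2 with hk
  have hk0 : k ≠ 0 := by
    intro h0
    rw [h0, zero_mul] at eb ec
    rcases hbc with h | h
    · exact h eb
    · exact h ec
  rw [mem_curveAt] at hqD
  have ea : a = k * (-(((p.re - x) * (q.re - p.re) + (p.im - y) * (q.im - p.im)) /
        ((q.re - p.re) ^ 2 + (q.im - p.im) ^ 2))) := by
    field_simp
    rw [eb, ec] at hqD
    linear_combination hqD
  rw [ea]
  nth_rw 1 [eb]
  nth_rw 1 [ec]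
  exact curveAt_smul hk0 _ _ _ _

theorem horizontal_eq_curveAt {c : ℝ} {p : ℍ} (hp : p ∈ horizontal c) :
    horizontal c = curveAt p 0 0 1 := by
  ext z
  have hp' : p.im = c := hp
  change z.im = c ↔ _
  rw [mem_curveAt, ← hp']
  constructor <;> intro h <;> linarith

theorem slanted_eq_curveAt {m k : ℝ} {p : ℍ} (hp : p ∈ slanted m k) :
    slanted m k = curveAt p 0 1 (-m) := by
  ext z
  have hp' : p.re = m * p.im + k := hp
  change z.re = m * z.im + k ↔ _
  rw [mem_curveAt, hp']
  constructor <;> intro h <;> linarith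

theorem curveAt_zero_eq {p : ℍ} {b c : ℝ} (h : b ≠ 0 ∨ c ≠ 0) :
    curveAt p 0 b c = horizontal p.im ∨ ∃ m k, curveAt p 0 b c = slanted m k := by
  by_cases hb : b = 0
  · left
    have hc : c ≠ 0 := h.resolve_left (not_not.2 hb)
    rw [horizontal_eq_curveAt (p := p) rfl, ← curveAt_smul hc p 0 0 1, hb]
    simp
  · right
    refine ⟨-c / b, p.re - (-c / b) * p.im, ?_⟩
    rw [slanted_eq_curveAt (p := p) (by simp [slanted]), ← curveAt_smul hb p 0 1]
    congr 1
    · ring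
    · ring
    · field_simp

theorem isConstantCurvatureCurve_horizontal {c : ℝ} (hc : 0 < c) :
    IsConstantCurvatureCurve (horizontal c) := by
  rw [horizontal_eq_curveAt (c := c) (p := ⟨⟨0, c⟩, hc⟩) rfl]
  exact isConstantCurvatureCurve_curveAt _ _ (Or.inr one_ne_zero)

theorem isConstantCurvatureCurve_slanted (m k : ℝ) : IsConstantCurvatureCurve (slanted m k) := by
  rw [slanted_eq_curveAt (p := ⟨⟨m * 1 + k, 1⟩, one_pos⟩) rfl]
  exact isConstantCurvatureCurve_curveAt _ _ (Or.inl one_ne_zero)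

theorem IsCircle.isConstantCurvatureCurve {C : Set ℍ} (hC : IsCircle C) :
    IsConstantCurvatureCurve C := by
  obtain ⟨x, y, r, hr, hry, rfl⟩ := hC
  have hy : 0 < y + r := by linarith
  rw [circle_eq_curveAt (p := ⟨⟨x, y + r⟩, hy⟩) (by simp [circle])]
  refine isConstantCurvatureCurve_curveAt _ _ (Or.inr ?_)
  simpa using hr.ne'

/-- On the horizontal line through `p` the equation reads `a * X ^ 2 + b * X = 0`, with second root
`-b / a`. -/
theorem curveAt_inter_horizontal {p : ℍ} {a b c e : ℝ}
    (h : curveAt p a b c ∩ horizontal e = {p}) : a = 0 ∨ b = 0 := by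
  have hp : p.im = e := (h.symm.subset rfl).2
  by_contra! hab
  let z : ℍ := ⟨⟨p.re - b / a, p.im⟩, p.im_pos⟩
  have hz1 : z.re = p.re - b / a := rfl
  have hz2 : z.im = p.im := rfl
  have hz : z ∈ curveAt p a b c ∩ horizontal e := by
    refine ⟨?_, hp⟩
    rw [mem_curveAt, hz1, hz2]
    have := hab.1
    field_simp
    ring
  rw [h, Set.mem_singleton_iff] at hz
  rw [hz] at hz1
  exact div_ne_zero hab.2 hab.1 (by linarith)

theorem touching_horizontal {c : ℝ} {p q : ℍ} (hq : q ∉ horizontal c) {D : Set ℍ}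
    (hD : D ∈ touching (horizontal c) p q) :
    D = curveAt p 0 (q.im - p.im) (-(q.re - p.re)) ∨
    D = curveAt p (q.im - p.im) 0 (-((q.re - p.re) ^ 2 + (q.im - p.im) ^ 2)) := by
  obtain ⟨hD, hqD, hi⟩ := hD
  have hp : p ∈ D ∩ horizontal c := hi.symm ▸ Set.mem_singleton p
  have hpc : p.im = c := hp.2
  have hy : q.im - p.im ≠ 0 := fun h => hq (by change q.im = c; linarith)
  obtain ⟨a, b, d, hbd, rfl⟩ := (isConstantCurvatureCurve_iff hp.1).1 hD
  rw [mem_curveAt] at hqD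
  rcases curveAt_inter_horizontal hi with rfl | rfl
  · left
    have hb : b ≠ 0 := by
      rintro rfl
      rcases mul_eq_zero.1 (by linarith : d * (q.im - p.im) = 0) with h | h
      · simp [h] at hbd
      · exact hy h
    rw [← curveAt_smul (div_ne_zero hb hy) p 0 (q.im - p.im)]
    congr 1
    · ring
    · field_simp
    · field_simp
      linear_combination hqD
  · right
    have ha : a ≠ 0 := by
      rintro rfl
      rcases mul_eq_zero.1 (by linarith : d * (q.im - p.im) = 0) with h | h
      · simp [h] at hbd
      · exact hy h
    rw [← curveAt_smul (div_ne_zero ha hy) p (q.im - p.im)]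
    congr 1
    · field_simp
    · ring
    · field_simp
      linear_combination hqD

theorem exists_touching_horizontal {c : ℝ} (hc : 0 < c) : ∃ p q, q ∉ horizontal c ∧
    ∃ D ∈ touching (horizontal c) p q, ∃ E ∈ touching (horizontal c) p q, D ≠ E := by
  let p : ℍ := ⟨⟨0, c⟩, hc⟩
  let q : ℍ := ⟨⟨1, c + 1⟩, by change 0 < c + 1; linarith⟩
  let z : ℍ := ⟨⟨2, c + 2⟩, by change 0 < c + 2; linarith⟩
  have p1 : p.re = 0 := rfl
  have p2 : p.im = c := rfl
  have q1 : q.re = 1 := rfl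
  have q2 : q.im = c + 1 := rfl
  have z1 : z.re = 2 := rfl
  have z2 : z.im = c + 2 := rfl
  refine ⟨p, q, ?_, curveAt p 0 1 (-1),
    ⟨isConstantCurvatureCurve_curveAt _ _ (Or.inl one_ne_zero), ?_, ?_⟩, curveAt p 1 0 (-2),
    ⟨isConstantCurvatureCurve_curveAt _ _ (Or.inr (by norm_num)), ?_, ?_⟩, ?_⟩
  · intro h
    have : q.im = c := h
    linarith
  · rw [mem_curveAt, p1, p2, q1, q2]; ring
  · refine Set.eq_singleton_iff_unique_mem.2 ⟨⟨self_mem_curveAt _ _ _ _, rfl⟩, ?_⟩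
    rintro w ⟨h1, h2 : w.im = c⟩
    rw [mem_curveAt] at h1
    exact ext_re_im (by rw [h2, p2] at h1; linarith) h2
  · rw [mem_curveAt, p1, p2, q1, q2]; ring
  · refine Set.eq_singleton_iff_unique_mem.2 ⟨⟨self_mem_curveAt _ _ _ _, rfl⟩, ?_⟩
    rintro w ⟨h1, h2 : w.im = c⟩
    rw [mem_curveAt, h2, p2] at h1
    have : (w.re - p.re) ^ 2 = 0 := by linarith
    exact ext_re_im (by linarith [pow_eq_zero_iff two_ne_zero |>.1 this]) h2
  · intro h
    have : z ∈ curveAt p 1 0 (-2) := by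
      rw [← h, mem_curveAt, p1, p2, z1, z2]; ring
    rw [mem_curveAt, p1, p2, z1, z2] at this
    norm_num at this

/-- The circles through `p` and `q` form a pencil. Once the coefficient of `Im w` is at least `2 + 2
* m ^ 2`, the second intersection with the Euclidean line falls below the real axis and is invisible
in the half-plane. -/
theorem exists_touching_slanted (m k : ℝ) : ∃ p q, q ∉ slanted m k ∧
    ∃ D : ℕ → Set ℍ, Function.Injective D ∧ ∀ n, D n ∈ touching (slanted m k) p q := by
  let p : ℍ := ⟨⟨m + k, 1⟩, one_pos⟩
  let q : ℍ := ⟨⟨m + k + 1, 1⟩, one_pos⟩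
  have p1 : p.re = m + k := rfl
  have p2 : p.im = 1 := rfl
  have q1 : q.re = m + k + 1 := rfl
  have q2 : q.im = 1 := rfl
  refine ⟨p, q, ?_, fun n => curveAt p 1 (-1) (2 + 2 * m ^ 2 + n), ?_, fun n =>
    ⟨isConstantCurvatureCurve_curveAt _ _ (Or.inl (by norm_num)), ?_, ?_⟩⟩
  · intro h
    have : q.re = m * q.im + k := h
    rw [q1, q2] at this
    linarith
  · intro i j hij
    have hi : (0 : ℝ) ≤ 2 * (2 + 2 * m ^ 2 + i) := by positivity
    -- A point of the `i`-th circle at height `1 / 2`. Since its height differs from that of `p`, it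
    -- determines the last coefficient.
    let z : ℍ := ⟨⟨m + k + (1 + √(2 * (2 + 2 * m ^ 2 + i))) / 2, 1 / 2⟩, one_half_pos⟩
    have z1 : z.re = m + k + (1 + √(2 * (2 + 2 * m ^ 2 + i))) / 2 := rfl
    have z2 : z.im = 1 / 2 := rfl
    have hs := Real.sq_sqrt hi
    have h1 : z ∈ curveAt p 1 (-1) (2 + 2 * m ^ 2 + i) := by
      rw [mem_curveAt, p1, p2, z1, z2]
      linear_combination hs / 4
    have h2 : z ∈ curveAt p 1 (-1) (2 + 2 * m ^ 2 + j) := by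
      have : curveAt p 1 (-1) (2 + 2 * m ^ 2 + i) = curveAt p 1 (-1) (2 + 2 * m ^ 2 + j) := hij
      rwa [← this]
    rw [mem_curveAt] at h1 h2
    rw [z2, p2] at h1 h2
    exact_mod_cast (by linarith : (i : ℝ) = j)
  · rw [mem_curveAt, p1, p2, q1, q2]; ring
  · refine Set.eq_singleton_iff_unique_mem.2
      ⟨⟨self_mem_curveAt _ _ _ _, by change m + k = m * 1 + k; ring⟩, ?_⟩
    rintro w ⟨h1, h2 : w.re = m * w.im + k⟩
    rw [mem_curveAt, p1, p2, h2] at h1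
    have h3 : (w.im - 1) * ((1 + m ^ 2) * (w.im - 1) - m + (2 + 2 * m ^ 2 + n)) = 0 := by
      linear_combination h1
    have hn : (0 : ℝ) ≤ n := n.cast_nonneg
    have h4 : w.im = 1 := by
      rcases mul_eq_zero.1 h3 with h | h
      · linarith
      · have := w.im_pos
        have := mul_pos (by positivity : 0 < 1 + m ^ 2) this
        nlinarith [sq_nonneg (m - 1)]
    exact ext_re_im (by rw [h2, h4, p1]; ring) h4

theorem not_isCircle_horizontal {c : ℝ} (hc : 0 < c) : ¬ IsCircle (horizontal c) := by
  intro h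
  obtain ⟨p, q, hq, D, hD, E, hE, hne⟩ := exists_touching_horizontal hc
  exact hne (h.touching_subsingleton hq hD hE)

theorem not_isCircle_slanted (m k : ℝ) : ¬ IsCircle (slanted m k) := by
  intro h
  obtain ⟨p, q, hq, D, hD, hE⟩ := exists_touching_slanted m k
  exact zero_ne_one (hD (h.touching_subsingleton hq (hE 0) (hE 1)))

/-- A Euclidean line. -/
def IsLine (C : Set ℍ) : Prop := (∃ c, 0 < c ∧ C = horizontal c) ∨ ∃ m k, C = slanted m k

theorem IsLine.exists_touching {C : Set ℍ} (h : IsLine C) : ∃ p q, q ∉ C ∧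
    ∃ D ∈ touching C p q, ∃ E ∈ touching C p q, D ≠ E := by
  rcases h with ⟨c, hc, rfl⟩ | ⟨m, k, rfl⟩
  · exact exists_touching_horizontal hc
  · obtain ⟨p, q, hq, D, hD, hE⟩ := exists_touching_slanted m k
    exact ⟨p, q, hq, D 0, hE 0, D 1, hE 1, hD.ne zero_ne_one⟩

/-! ### Inversions and straightening of curves -/

/-- The trace of the generalized circle with equation `a |z|² + b Re z + c Im z + d = 0`. -/
def generalizedCircle (a b c d : ℝ) : Set ℍ :=
  {z | a * (z.re ^ 2 + z.im ^ 2) + b * z.re + c * z.im + d = 0}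

theorem generalizedCircle_eq_curveAt {a b c d : ℝ} {p : ℍ} (hp : p ∈ generalizedCircle a b c d) :
    generalizedCircle a b c d = curveAt p a (b + 2 * a * p.re) (c + 2 * a * p.im) := by
  ext z
  have hp' : a * (p.re ^ 2 + p.im ^ 2) + b * p.re + c * p.im + d = 0 := hp
  change a * (z.re ^ 2 + z.im ^ 2) + b * z.re + c * z.im + d = 0 ↔ _
  rw [mem_curveAt]
  exact ⟨fun h => by linear_combination h - hp', fun h => by linear_combination h + hp'⟩

/-- At a point of the curve, `b ^ 2 + c ^ 2 - 4 * a * d` is the squared norm of the gradient of the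
equation, so its positivity excludes degenerate circles. -/
theorem isConstantCurvatureCurve_generalizedCircle {a b c d : ℝ}
    (h : 0 < b ^ 2 + c ^ 2 - 4 * a * d) (hne : (generalizedCircle a b c d).Nonempty) :
    IsConstantCurvatureCurve (generalizedCircle a b c d) := by
  obtain ⟨p, hp⟩ := hne
  have hp' : a * (p.re ^ 2 + p.im ^ 2) + b * p.re + c * p.im + d = 0 := hp
  rw [generalizedCircle_eq_curveAt hp]
  refine isConstantCurvatureCurve_curveAt _ _ ?_
  by_contra! h0
  have : b ^ 2 + c ^ 2 - 4 * a * d = 0 := by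
    linear_combination (b + 2 * a * p.re) * h0.1 + (c + 2 * a * p.im) * h0.2 - 4 * a * hp'
  linarith

theorem IsConstantCurvatureCurve.eq_generalizedCircle {C : Set ℍ}
    (h : IsConstantCurvatureCurve C) :
    ∃ a b c d, 0 < b ^ 2 + c ^ 2 - 4 * a * d ∧ C = generalizedCircle a b c d := by
  obtain ⟨p, hp⟩ := h.nonempty
  obtain ⟨a, b, c, hbc, rfl⟩ := (isConstantCurvatureCurve_iff hp).1 h
  refine ⟨a, b - 2 * a * p.re, c - 2 * a * p.im,
    a * (p.re ^ 2 + p.im ^ 2) - b * p.re - c * p.im, ?_, ?_⟩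
  · have : 0 < b ^ 2 + c ^ 2 := by rcases hbc with h | h <;> positivity
    linarith
  · rw [generalizedCircle_eq_curveAt (p := p)]
    · congr 1 <;> ring
    · change _ = (0 : ℝ)
      ring

theorem isometry_of_forall_sq {f : ℍ → ℍ} (h : ∀ z w : ℍ,
    (((f z).re - (f w).re) ^ 2 + ((f z).im - (f w).im) ^ 2) * (z.im * w.im) =
    ((z.re - w.re) ^ 2 + (z.im - w.im) ^ 2) * ((f z).im * (f w).im)) : Isometry f := by
  refine Isometry.of_dist_eq fun z w => ?_
  have hd : ∀ z w : ℍ, dist (z : ℂ) w ^ 2 = (z.re - w.re) ^ 2 + (z.im - w.im) ^ 2 := fun z w => by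
    rw [Complex.dist_eq, Complex.sq_norm, Complex.normSq_apply]
    simp
    ring
  have hc : Real.cosh (dist (f z) (f w)) = Real.cosh (dist z w) := by
    rw [cosh_dist, cosh_dist, hd, hd]
    have h1 := z.im_ne_zero
    have h2 := w.im_ne_zero
    have h3 := (f z).im_ne_zero
    have h4 := (f w).im_ne_zero
    field_simp
    linear_combination h z w
  have := le_antisymm (Real.cosh_le_cosh.1 hc.le) (Real.cosh_le_cosh.1 hc.ge)
  rwa [abs_of_nonneg dist_nonneg, abs_of_nonneg dist_nonneg] at this

theorem sq_re_sub_add_sq_im_pos (z : ℍ) (t : ℝ) : 0 < (z.re - t) ^ 2 + z.im ^ 2 := by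
  have := z.im_pos
  positivity

/-- The inversion in the circle of radius `1` centred at the real point `t`. -/
noncomputable def inversionFun (t : ℝ) (z : ℍ) : ℍ :=
  ⟨⟨t + (z.re - t) / ((z.re - t) ^ 2 + z.im ^ 2), z.im / ((z.re - t) ^ 2 + z.im ^ 2)⟩,
    div_pos z.im_pos (sq_re_sub_add_sq_im_pos z t)⟩

theorem inversionFun_re (t : ℝ) (z : ℍ) :
    (inversionFun t z).re = t + (z.re - t) / ((z.re - t) ^ 2 + z.im ^ 2) := rfl

theorem inversionFun_im (t : ℝ) (z : ℍ) :
    (inversionFun t z).im = z.im / ((z.re - t) ^ 2 + z.im ^ 2) := rfl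

theorem inversionFun_normSq (t : ℝ) (z : ℍ) :
    ((inversionFun t z).re - t) ^ 2 + (inversionFun t z).im ^ 2 =
      1 / ((z.re - t) ^ 2 + z.im ^ 2) := by
  have := (sq_re_sub_add_sq_im_pos z t).ne'
  rw [inversionFun_re, inversionFun_im]
  field_simp
  ring

theorem inversionFun_involutive (t : ℝ) : Function.Involutive (inversionFun t) := by
  intro z
  have := (sq_re_sub_add_sq_im_pos z t).ne'
  apply ext_re_im
  · rw [inversionFun_re, inversionFun_normSq, inversionFun_re]
    field_simp
    ring
  · rw [inversionFun_im, inversionFun_normSq, inversionFun_im]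
    field_simp

/-- The inversion in the circle of radius `1` centred at the real point `t`, as a bijection. -/
noncomputable def inversion (t : ℝ) : ℍ ≃ ℍ := (inversionFun_involutive t).toPerm

theorem isometry_inversion (t : ℝ) : Isometry (inversion t) := by
  refine isometry_of_forall_sq fun z w => ?_
  change (((inversionFun t z).re - (inversionFun t w).re) ^ 2 +
    ((inversionFun t z).im - (inversionFun t w).im) ^ 2) * (z.im * w.im) =
    _ * ((inversionFun t z).im * (inversionFun t w).im)
  have h1 := (sq_re_sub_add_sq_im_pos z t).ne'
  have h2 := (sq_re_sub_add_sq_im_pos w t).ne'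
  rw [inversionFun_re, inversionFun_im, inversionFun_re, inversionFun_im]
  generalize z.re = a at *
  generalize w.re = b at *
  generalize z.im = c at *
  generalize w.im = d at *
  field_simp
  ring

theorem inversion_image_generalizedCircle (t a b c d : ℝ) :
    inversion t '' generalizedCircle a b c d = generalizedCircle (a * t ^ 2 + b * t + d)
      (b + 2 * a * t - 2 * (a * t ^ 2 + b * t + d) * t) c
      (a - (b + 2 * a * t) * t + (a * t ^ 2 + b * t + d) * t ^ 2) := by
  rw [Equiv.image_eq_preimage_symm]
  ext z
  have h1 := (sq_re_sub_add_sq_im_pos z t).ne'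
  have e : (a * t ^ 2 + b * t + d) * (z.re ^ 2 + z.im ^ 2) +
      (b + 2 * a * t - 2 * (a * t ^ 2 + b * t + d) * t) * z.re + c * z.im +
      (a - (b + 2 * a * t) * t + (a * t ^ 2 + b * t + d) * t ^ 2) =
      ((z.re - t) ^ 2 + z.im ^ 2) * (a * ((inversionFun t z).re ^ 2 + (inversionFun t z).im ^ 2) +
        b * (inversionFun t z).re + c * (inversionFun t z).im + d) := by
    rw [inversionFun_re, inversionFun_im]
    field_simp
    ring
  change a * ((inversionFun t z).re ^ 2 + (inversionFun t z).im ^ 2) + b * (inversionFun t z).re +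
    c * (inversionFun t z).im + d = 0 ↔ _ = (0 : ℝ)
  rw [e]
  exact ⟨fun h => by rw [h, mul_zero], fun h => (mul_eq_zero.1 h).resolve_left h1⟩

theorem preservesCurves_inversion (t : ℝ) : PreservesCurves (inversion t) := by
  intro C hC
  have hne := hC.nonempty.image (inversion t)
  obtain ⟨a, b, c, d, hpos, rfl⟩ := hC.eq_generalizedCircle
  rw [inversion_image_generalizedCircle] at hne ⊢
  refine isConstantCurvatureCurve_generalizedCircle ?_ hne
  -- The discriminant is invariant under inversion.
  convert hpos using 1
  ring

/-- A curve that is not a circle comes from a line or from a Euclidean circle that reaches the real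
axis at some `t`; inversion at `t` straightens the latter. A Euclidean circle without real points
that meets the half-plane lies inside it and is a hyperbolic circle. -/
theorem IsConstantCurvatureCurve.exists_isLine {C : Set ℍ} (h : IsConstantCurvatureCurve C)
    (hC : ¬ IsCircle C) : ∃ g : ℍ ≃ ℍ, Isometry g ∧ PreservesCurves g ∧ IsLine (g '' C) := by
  obtain ⟨a, b, c, d, hpos, hCeq⟩ := h.eq_generalizedCircle
  have line : ∀ b c d, IsConstantCurvatureCurve (generalizedCircle 0 b c d) →
      0 < b ^ 2 + c ^ 2 → IsLine (generalizedCircle 0 b c d) := by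
    intro b c d h hpos
    obtain ⟨p, hp⟩ := h.nonempty
    rw [generalizedCircle_eq_curveAt hp]
    have hbc : b + 2 * 0 * p.re ≠ 0 ∨ c + 2 * 0 * p.im ≠ 0 := by
      by_contra! h0
      norm_num at h0
      rw [h0.1, h0.2] at hpos
      norm_num at hpos
    rcases curveAt_zero_eq (p := p) hbc with h | h
    · exact Or.inl ⟨p.im, p.im_pos, h⟩
    · exact Or.inr h
  by_cases ha : a = 0
  · subst ha
    refine ⟨Equiv.refl ℍ, isometry_id, fun D hD => by simpa using hD, ?_⟩
    rw [Equiv.coe_refl, Set.image_id, hCeq]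
    exact line b c d (hCeq ▸ h) (by linarith)
  · obtain ⟨t, ht⟩ : ∃ t, a * t ^ 2 + b * t + d = 0 := by
      by_contra! hno
      have hdisc : b ^ 2 - 4 * a * d < 0 := by
        by_contra! hd
        obtain ⟨s, hs⟩ : ∃ s, s ^ 2 = b ^ 2 - 4 * a * d := ⟨_, Real.sq_sqrt hd⟩
        refine hno ((-b + s) / (2 * a)) ?_
        field_simp
        linear_combination hs
      have hr : 0 < √(b ^ 2 + c ^ 2 - 4 * a * d) := Real.sqrt_pos.2 hpos
      have hr2 := Real.sq_sqrt hpos.le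
      set r := √(b ^ 2 + c ^ 2 - 4 * a * d)
      have key : ∀ p ∈ C, (2 * a * p.re + b) ^ 2 + (2 * a * p.im + c) ^ 2 = r ^ 2 := by
        intro p hp
        rw [hCeq] at hp
        have hp' : a * (p.re ^ 2 + p.im ^ 2) + b * p.re + c * p.im + d = 0 := hp
        linear_combination 4 * a * hp' - hr2
      have hrc : r ^ 2 < c ^ 2 := by linarith
      have h2 : 0 < -c / a := by
        obtain ⟨p, hp⟩ := h.nonempty
        have hk := key p hp
        have : a * c < 0 := by nlinarith [p.im_pos, sq_nonneg (2 * a * p.re + b), sq_nonneg (a * p.im)]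
        rcases lt_or_gt_of_ne ha with h | h
        · exact div_pos_of_neg_of_neg (by nlinarith) h
        · exact div_pos (by nlinarith) h
      refine hC ⟨-b / (2 * a), -c / (2 * a), r / (2 * |a|), by positivity, ?_, ?_⟩
      · have e : -c / (2 * a) = -c / a / 2 := by field_simp
        refine lt_of_pow_lt_pow_left₀ 2 (by rw [e]; positivity) ?_
        rw [div_pow, div_pow, mul_pow, mul_pow, sq_abs]
        exact div_lt_div_of_pos_right (by rwa [neg_sq]) (by positivity)
      · rw [hCeq]
        ext z
        change a * (z.re ^ 2 + z.im ^ 2) + b * z.re + c * z.im + d = 0 ↔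
          (z.re - -b / (2 * a)) ^ 2 + (z.im - -c / (2 * a)) ^ 2 = (r / (2 * |a|)) ^ 2
        rw [div_pow, mul_pow, sq_abs, hr2]
        constructor
        · intro hz
          field_simp
          linear_combination 4 * a * hz
        · intro hz
          field_simp at hz
          refine mul_left_cancel₀ ha ?_
          linear_combination hz / 4
    refine ⟨inversion t, isometry_inversion t, preservesCurves_inversion t, ?_⟩
    have hI := preservesCurves_inversion t C h
    rw [hCeq, inversion_image_generalizedCircle, ht] at hI ⊢
    refine line _ _ _ hI ?_
    have : (b + 2 * a * t - 2 * 0 * t) ^ 2 + c ^ 2 = b ^ 2 + c ^ 2 - 4 * a * d := by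
      linear_combination 4 * a * ht
    rw [this]
    exact hpos

/-! ### Types of curves under a curve-preserving bijection -/

/-- Otherwise the image could be straightened to a line, and two curves touching that line would
pull back to two curves touching the circle `C` at one point through one exterior point. -/
theorem PreservesCurves.isCircle_image {f : ℍ ≃ ℍ} (hf : PreservesCurves f) {C : Set ℍ}
    (hC : IsCircle C) : IsCircle (f '' C) := by
  by_contra hno
  obtain ⟨g, -, hg, hl⟩ := (hf C hC.isConstantCurvatureCurve).exists_isLine hno
  obtain ⟨p, q, hq, D, hD, E, hE, hne⟩ := hl.exists_touching
  have hh := (hf.trans hg).symm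
  have e : (f.trans g).symm '' (g '' (f '' C)) = C := by
    rw [← Set.image_comp g f, ← Equiv.coe_trans, Equiv.symm_image_image]
  have hD' := hh.image_mem_touching hD
  have hE' := hh.image_mem_touching hE
  rw [e] at hD' hE'
  have hq' : (f.trans g).symm q ∉ C := by
    intro h
    apply hq
    rw [← Set.image_comp g f, ← Equiv.coe_trans]
    exact ⟨_, h, (f.trans g).apply_symm_apply q⟩
  exact hne ((f.trans g).symm.injective.image_injective (hC.touching_subsingleton hq' hD' hE'))

theorem PreservesCurves.exists_isometry_image_horizontal {f : ℍ ≃ ℍ} (hf : PreservesCurves f)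
    {c : ℝ} (hc : 0 < c) : ∃ g : ℍ ≃ ℍ, Isometry g ∧ PreservesCurves g ∧
      ∃ c' > 0, (f.trans g) '' horizontal c = horizontal c' := by
  have hno : ¬ IsCircle (f '' horizontal c) := by
    intro h
    have := hf.symm.isCircle_image h
    rw [Equiv.symm_image_image] at this
    exact not_isCircle_horizontal hc this
  obtain ⟨g, hgi, hg, hl⟩ := (hf _ (isConstantCurvatureCurve_horizontal hc)).exists_isLine hno
  refine ⟨g, hgi, hg, ?_⟩
  rw [Equiv.coe_trans, Set.image_comp]
  rcases hl with ⟨c', hc', h⟩ | ⟨m, k, h⟩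
  · exact ⟨c', hc', h⟩
  · exfalso
    obtain ⟨p, q, hq, D, hD, hmem⟩ := exists_touching_slanted m k
    have hh := (hf.trans hg).symm
    have e : (f.trans g).symm '' slanted m k = horizontal c := by
      rw [← h, ← Set.image_comp g f, ← Equiv.coe_trans, Equiv.symm_image_image]
    have hmem' := fun n => hh.image_mem_touching (hmem n)
    rw [e] at hmem'
    have hq' : (f.trans g).symm q ∉ horizontal c := by
      intro h'
      apply hq
      rw [← h, ← Set.image_comp g f, ← Equiv.coe_trans]
      exact ⟨_, h', (f.trans g).apply_symm_apply q⟩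
    have hinj : Function.Injective fun n => (f.trans g).symm '' D n :=
      (f.trans g).symm.injective.image_injective.comp hD
    -- Pigeonhole: three distinct touching curves, but only two candidates for a horizontal line.
    have h01 := hinj.ne (show (0 : ℕ) ≠ 1 by norm_num)
    have h02 := hinj.ne (show (0 : ℕ) ≠ 2 by norm_num)
    have h12 := hinj.ne (show (1 : ℕ) ≠ 2 by norm_num)
    rcases touching_horizontal hq' (hmem' 0) with h0 | h0 <;>
    rcases touching_horizontal hq' (hmem' 1) with h1 | h1 <;>
    rcases touching_horizontal hq' (hmem' 2) with h2 | h2 <;>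
    first
    | exact h01 (h0.trans h1.symm)
    | exact h02 (h0.trans h2.symm)
    | exact h12 (h1.trans h2.symm)

/-! ### Straight lines under a normalized map -/

theorem horizontal_inter_slanted {e : ℝ} (he : 0 < e) (m k : ℝ) :
    horizontal e ∩ slanted m k = {⟨⟨m * e + k, e⟩, he⟩} := by
  refine Set.eq_singleton_iff_unique_mem.2 ⟨⟨rfl, rfl⟩, ?_⟩
  rintro z ⟨h1 : z.im = e, h2 : z.re = m * z.im + k⟩
  exact ext_re_im (by rw [h2, h1]; rfl) h1

theorem image_inter_eq_singleton (f : ℍ ≃ ℍ) {C D : Set ℍ} {p : ℍ} (h : C ∩ D = {p}) :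
    f '' C ∩ f '' D = {f p} := by
  rw [← Set.image_inter f.injective, h, Set.image_singleton]

/-- The image meets a horizontal line only in `f p`, so it is a straight line or is tangent there.
In the tangent case, compare it with the image of a circle tangent to the original horizontal line
at `p`: both images are tangent at `f p` and share `f z`, so they coincide, and a slanted line would
be a circle. -/
theorem PreservesCurves.image_slanted {f : ℍ ≃ ℍ} (hf : PreservesCurves f) {c c' : ℝ}
    (hc : 0 < c) (hfc : f '' horizontal c = horizontal c') (m k : ℝ) :
    ∃ m' k', f '' slanted m k = slanted m' k' := by
  set p : ℍ := ⟨⟨m * c + k, c⟩, hc⟩ with hp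
  have p1 : p.re = m * c + k := rfl
  have p2 : p.im = c := rfl
  -- a circle tangent to the horizontal line at `p`, and its second intersection with the line
  set C := circle p.re (c + 1) 1 with hC
  have hCc : IsCircle C := ⟨_, _, _, one_pos, by linarith, rfl⟩
  have hCp : C ∩ horizontal c = {p} := by
    refine Set.eq_singleton_iff_unique_mem.2 ⟨⟨?_, rfl⟩, ?_⟩
    · change (p.re - p.re) ^ 2 + (p.im - (c + 1)) ^ 2 = 1 ^ 2
      rw [p2]; ring
    · rintro z ⟨h1 : (z.re - p.re) ^ 2 + (z.im - (c + 1)) ^ 2 = 1 ^ 2, h2 : z.im = c⟩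
      rw [h2] at h1
      have : (z.re - p.re) ^ 2 = 0 := by linarith
      exact ext_re_im (by linarith [pow_eq_zero_iff two_ne_zero |>.1 this]) h2
  have hEp : slanted m k ∩ horizontal c = {p} := by
    rw [Set.inter_comm, horizontal_inter_slanted hc]
  have hm : 0 < 1 + m ^ 2 := by positivity
  -- The second intersection of the slanted line with the circle of radius `1` resting on the
  -- horizontal line at `p`.
  obtain ⟨z, hz1, hz2⟩ : ∃ z : ℍ, z.re = m * (c + 2 / (1 + m ^ 2)) + k ∧
      z.im = c + 2 / (1 + m ^ 2) :=
    ⟨⟨⟨m * (c + 2 / (1 + m ^ 2)) + k, c + 2 / (1 + m ^ 2)⟩, by positivity⟩, rfl, rfl⟩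
  have hzE : z ∈ slanted m k := by change z.re = m * z.im + k; rw [hz1, hz2]
  have hzC : z ∈ C := by
    change (z.re - p.re) ^ 2 + (z.im - (c + 1)) ^ 2 = 1 ^ 2
    rw [hz1, hz2, p1]
    field_simp
    ring
  have hzp : f p ≠ f z := by
    intro h
    have := congrArg UpperHalfPlane.im (f.injective h)
    rw [hz2, p2] at this
    have : 0 < 2 / (1 + m ^ 2) := by positivity
    linarith
  have hCp' := image_inter_eq_singleton f hCp
  have hEp' := image_inter_eq_singleton f hEp
  rw [hfc] at hCp' hEp'
  have hfE := hf _ (isConstantCurvatureCurve_slanted m k)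
  obtain ⟨a, b, d, hbd, hE⟩ := (isConstantCurvatureCurve_iff (hEp'.symm.subset rfl).1).1 hfE
  obtain ⟨x, y, r, hr, hry, hC'⟩ := hf.isCircle_image hCc
  have hfC := hC'.trans (circle_eq_curveAt (hC' ▸ (hCp'.symm.subset rfl).1))
  set β := 2 * ((f p).re - x)
  set δ := 2 * ((f p).im - y)
  have hzE' := hE ▸ Set.mem_image_of_mem f hzE
  have hzC' := hfC ▸ Set.mem_image_of_mem f hzC
  rw [hE] at hEp'
  rw [hfC] at hCp'
  have hβ : β = 0 := (curveAt_inter_horizontal hCp').resolve_left one_ne_zero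
  by_cases ha : a = 0
  · rw [ha] at hE hEp'
    rcases curveAt_zero_eq (p := f p) hbd with h | ⟨m', k', h⟩
    · have hfp : (f p).im = c' := (hEp'.symm.subset rfl).2
      exfalso
      rw [← hE, hfp, ← hfc] at h
      have h' := f.injective.image_injective h
      rw [h', Set.inter_self] at hEp
      have := (isConstantCurvatureCurve_horizontal hc).infinite
      rw [hEp] at this
      exact this (Set.finite_singleton p)
    · exact ⟨m', k', hE.trans h⟩
  · exfalso
    have hb : b = 0 := (curveAt_inter_horizontal hEp').resolve_left ha
    rw [mem_curveAt, hb] at hzE'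
    rw [mem_curveAt, hβ] at hzC'
    have hn := sq_add_sq_pos_of_ne hzp
    have hy : (f z).im - (f p).im ≠ 0 := by
      intro h
      rw [h] at hzC' hn
      linarith
    have hd : d = a * δ := by
      refine mul_right_cancel₀ hy ?_
      linear_combination hzE' - a * hzC'
    have heq : f '' slanted m k = f '' C := by
      rw [hE, hfC, hβ, hb, hd, ← curveAt_smul ha (f p) 1 0 δ]
      congr 1 <;> ring
    exact not_isCircle_slanted m k ((f.injective.image_injective heq) ▸ hCc)

/-- Slanted lines pull back to slanted lines, so the image meets every slanted line exactly once. A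
Euclidean circle is bounded and misses some vertical line. -/
theorem PreservesCurves.image_horizontal {f : ℍ ≃ ℍ} (hf : PreservesCurves f) {c c' : ℝ}
    (hc' : 0 < c') (hfc : f '' horizontal c = horizontal c') {e : ℝ} (he : 0 < e) :
    ∃ e' > 0, f '' horizontal e = horizontal e' := by
  have hfc' : f.symm '' horizontal c' = horizontal c := by rw [← hfc, f.symm_image_image]
  have hinter : ∀ m k, ∃ q, f '' horizontal e ∩ slanted m k = {q} := by
    intro m k
    obtain ⟨m', k', h⟩ := hf.symm.image_slanted hc' hfc' m k
    have := image_inter_eq_singleton f (horizontal_inter_slanted he m' k')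
    rw [← h, f.image_symm_image] at this
    exact ⟨_, this⟩
  have hD := hf _ (isConstantCurvatureCurve_horizontal he)
  obtain ⟨p, hp⟩ := hD.nonempty
  obtain ⟨a, b, d, hbd, hEq⟩ := (isConstantCurvatureCurve_iff hp).1 hD
  by_cases ha : a = 0
  · rw [ha] at hEq
    rcases curveAt_zero_eq (p := p) hbd with h | ⟨m', k', h⟩
    · exact ⟨p.im, p.im_pos, hEq.trans h⟩
    · exfalso
      obtain ⟨q, hq⟩ := hinter m' k'
      rw [hEq, h, Set.inter_self] at hq
      have := (isConstantCurvatureCurve_slanted m' k').infinite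
      rw [hq] at this
      exact this (Set.finite_singleton q)
  · exfalso
    -- With `S = (b / a) ^ 2 + (d / a) ^ 2`, the circle has radius `√S / 2` and its centre is at
    -- horizontal offset `-(b / a) / 2`. The vertical line at offset `S + 1` from the centre misses
    -- it.
    obtain ⟨X, hX⟩ : ∃ X, X = -(b / a) / 2 + ((b / a) ^ 2 + (d / a) ^ 2 + 1) := ⟨_, rfl⟩
    obtain ⟨q, hq⟩ := hinter 0 (p.re + X)
    obtain ⟨h1, h2⟩ := hq.symm.subset (Set.mem_singleton q)
    have h2' : q.re = p.re + X := by
      have : q.re = 0 * q.im + (p.re + X) := h2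
      linarith
    rw [hEq, mem_curveAt, h2'] at h1
    have h3 : (X + b / a / 2) ^ 2 + (q.im - p.im + d / a / 2) ^ 2 =
        ((b / a) ^ 2 + (d / a) ^ 2) / 4 := by
      have h4 : X ^ 2 + (q.im - p.im) ^ 2 + b / a * X + d / a * (q.im - p.im) = 0 := by
        field_simp
        linear_combination h1
      linear_combination h4
    rw [hX] at h3
    nlinarith [sq_nonneg (q.im - p.im + d / a / 2), sq_nonneg (b / a), sq_nonneg (d / a),
      sq_nonneg ((b / a) ^ 2 + (d / a) ^ 2)]

/-- A bijection that preserves constant curvature curves and maps some horizontal line to a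
horizontal line maps all horizontal lines to horizontal lines. -/
theorem PreservesCurves.im_eq {f : ℍ ≃ ℍ} (hf : PreservesCurves f) {c c' : ℝ}
    (hc' : 0 < c') (hfc : f '' horizontal c = horizontal c') (z : ℍ) :
    f '' horizontal z.im = horizontal (f z).im := by
  obtain ⟨e', -, h⟩ := hf.image_horizontal hc' hfc z.im_pos
  have : f z ∈ horizontal e' := h ▸ Set.mem_image_of_mem f (by rfl : z ∈ horizontal z.im)
  rw [h, show (f z).im = e' from this]

/-! ### Extreme points of circles -/

theorem circle_inter_horizontal {x y r e : ℝ} {p : ℍ}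
    (h : circle x y r ∩ horizontal e = {p}) : p.re = x := by
  have hp := h.symm.subset (Set.mem_singleton p)
  have h1 : (p.re - x) ^ 2 + (p.im - y) ^ 2 = r ^ 2 := hp.1
  let z : ℍ := ⟨⟨2 * x - p.re, p.im⟩, p.im_pos⟩
  have hz : z ∈ circle x y r ∩ horizontal e := by
    refine ⟨?_, hp.2⟩
    change (2 * x - p.re - x) ^ 2 + (p.im - y) ^ 2 = r ^ 2
    linear_combination h1
  rw [h] at hz
  have : 2 * x - p.re = p.re := congrArg UpperHalfPlane.re (Set.mem_singleton_iff.1 hz)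
  linarith

theorem circle_inter_vertical {x y r e : ℝ} (hr : 0 < r) (hry : r < y) {p : ℍ}
    (h : circle x y r ∩ {z | z.re = e} = {p}) : p.im = y := by
  have hp := h.symm.subset (Set.mem_singleton p)
  have h1 : (p.re - x) ^ 2 + (p.im - y) ^ 2 = r ^ 2 := hp.1
  have hpos : 0 < 2 * y - p.im := by nlinarith [sq_nonneg (p.re - x)]
  let z : ℍ := ⟨⟨p.re, 2 * y - p.im⟩, hpos⟩
  have hz : z ∈ circle x y r ∩ {z | z.re = e} := by
    refine ⟨?_, hp.2⟩
    change (p.re - x) ^ 2 + (2 * y - p.im - y) ^ 2 = r ^ 2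
    linear_combination h1
  rw [h] at hz
  have : 2 * y - p.im = p.im := congrArg UpperHalfPlane.im (Set.mem_singleton_iff.1 hz)
  linarith

theorem circle_inter_horizontal_eq {z : ℍ} {y r : ℝ} (h : (z.im - y) ^ 2 = r ^ 2) :
    circle z.re y r ∩ horizontal z.im = {z} := by
  refine Set.eq_singleton_iff_unique_mem.2 ⟨⟨?_, rfl⟩, ?_⟩
  · change (z.re - z.re) ^ 2 + (z.im - y) ^ 2 = r ^ 2
    rw [h]; ring
  · rintro w ⟨h1 : (w.re - z.re) ^ 2 + (w.im - y) ^ 2 = r ^ 2, h2 : w.im = z.im⟩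
    rw [h2, h] at h1
    have : (w.re - z.re) ^ 2 = 0 := by linarith
    exact ext_re_im (by linarith [pow_eq_zero_iff two_ne_zero |>.1 this]) h2

theorem circle_inter_vertical_eq {z : ℍ} {x r : ℝ} (h : (z.re - x) ^ 2 = r ^ 2) :
    circle x z.im r ∩ {w | w.re = z.re} = {z} := by
  refine Set.eq_singleton_iff_unique_mem.2 ⟨⟨?_, rfl⟩, ?_⟩
  · change (z.re - x) ^ 2 + (z.im - z.im) ^ 2 = r ^ 2
    rw [h]; ring
  · rintro w ⟨h1 : (w.re - x) ^ 2 + (w.im - z.im) ^ 2 = r ^ 2, h2 : w.re = z.re⟩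
    rw [h2, h] at h1
    have : (w.im - z.im) ^ 2 = 0 := by linarith
    exact ext_re_im h2 (by linarith [pow_eq_zero_iff two_ne_zero |>.1 this])

/-- The circle with vertical diameter from `z` to `w` touches the horizontal lines through them. Its
image is a circle touching horizontal lines at `f z` and `f w`, so both lie on the vertical line
through its centre. -/
theorem PreservesCurves.re_eq {f : ℍ ≃ ℍ} (hf : PreservesCurves f) {c c' : ℝ}
    (hc' : 0 < c') (hfc : f '' horizontal c = horizontal c') {z w : ℍ}
    (h : z.re = w.re) : (f z).re = (f w).re := by
  wlog hlt : z.im ≤ w.im generalizing z w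
  · exact (this h.symm (le_of_not_ge hlt)).symm
  rcases hlt.eq_or_lt with heq | hlt
  · rw [ext_re_im h heq]
  have hC : IsCircle (circle z.re ((z.im + w.im) / 2) ((w.im - z.im) / 2)) :=
    ⟨_, _, _, by linarith, by linarith [z.im_pos], rfl⟩
  obtain ⟨x, y, r, hr, hry, he⟩ := hf.isCircle_image hC
  have h1 := image_inter_eq_singleton f
    (circle_inter_horizontal_eq (z := z) (y := (z.im + w.im) / 2) (r := (w.im - z.im) / 2)
      (by ring))
  have h2 := image_inter_eq_singleton f
    (circle_inter_horizontal_eq (z := w) (y := (z.im + w.im) / 2) (r := (w.im - z.im) / 2)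
      (by ring))
  rw [he, hf.im_eq hc' hfc] at h1
  rw [← h, he, hf.im_eq hc' hfc] at h2
  rw [circle_inter_horizontal h1, circle_inter_horizontal h2]

theorem PreservesCurves.image_vertical {f : ℍ ≃ ℍ} (hf : PreservesCurves f) {c c' : ℝ}
    (hc : 0 < c) (hc' : 0 < c') (hfc : f '' horizontal c = horizontal c') (z : ℍ) :
    f '' {w | w.re = z.re} = {w | w.re = (f z).re} := by
  have hfc' : f.symm '' horizontal c' = horizontal c := by rw [← hfc, f.symm_image_image]
  ext w
  constructor
  · rintro ⟨v, hv, rfl⟩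
    exact hf.re_eq hc' hfc hv
  · intro hw
    refine ⟨f.symm w, ?_, f.apply_symm_apply w⟩
    have := hf.symm.re_eq hc hfc' (show w.re = (f z).re from hw)
    rwa [f.symm_apply_apply] at this

/-- The images of the four extreme points of a circle are extreme points of its image. -/
theorem PreservesCurves.extreme_points {f : ℍ ≃ ℍ} (hf : PreservesCurves f) {c c' : ℝ}
    (hc : 0 < c) (hc' : 0 < c') (hfc : f '' horizontal c = horizontal c') {o n s e : ℍ} {r : ℝ}
    (hr : 0 < r) (hn : n.re = o.re) (hn' : n.im = o.im + r) (hs : s.re = o.re)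
    (hs' : s.im = o.im - r) (he : e.re = o.re + r) (he' : e.im = o.im) :
    (f n).im + (f s).im = 2 * (f o).im ∧ |(f n).im - (f o).im| = |(f e).re - (f o).re| := by
  have hC : IsCircle (circle o.re o.im r) := ⟨_, _, _, hr, by linarith [s.im_pos], rfl⟩
  obtain ⟨x, y, r', hr', hry, hE⟩ := hf.isCircle_image hC
  have h1 := image_inter_eq_singleton f
    (circle_inter_horizontal_eq (z := n) (y := o.im) (r := r) (by rw [hn']; ring))
  have h2 := image_inter_eq_singleton f
    (circle_inter_horizontal_eq (z := s) (y := o.im) (r := r) (by rw [hs']; ring))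
  have h3 := image_inter_eq_singleton f
    (circle_inter_vertical_eq (z := e) (x := o.re) (r := r) (by rw [he]; ring))
  rw [hn, hE, hf.im_eq hc' hfc] at h1
  rw [hs, hE, hf.im_eq hc' hfc] at h2
  rw [he', hE, hf.image_vertical hc hc' hfc] at h3
  have n1 := circle_inter_horizontal h1
  have s1 := circle_inter_horizontal h2
  have e1 := circle_inter_vertical hr' hry h3
  have o1 : (f o).re = x := (hf.re_eq hc' hfc hn).symm.trans n1
  have o2 : (f o).im = y := by
    have h := hf.im_eq hc' hfc e
    have : f o ∈ horizontal (f e).im := h ▸ Set.mem_image_of_mem f (show o.im = e.im from he'.symm)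
    exact (show (f o).im = (f e).im from this).trans e1
  have n2 : ((f n).re - x) ^ 2 + ((f n).im - y) ^ 2 = r' ^ 2 :=
    (h1.symm.subset (Set.mem_singleton _)).1
  have s2 : ((f s).re - x) ^ 2 + ((f s).im - y) ^ 2 = r' ^ 2 :=
    (h2.symm.subset (Set.mem_singleton _)).1
  have e2 : ((f e).re - x) ^ 2 + ((f e).im - y) ^ 2 = r' ^ 2 :=
    (h3.symm.subset (Set.mem_singleton _)).1
  rw [n1] at n2
  rw [s1] at s2
  rw [e1] at e2
  rw [o1, o2]
  constructor
  · have hne : (f n).im - y ≠ (f s).im - y := by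
      intro h
      have hns : n = s := f.injective (ext_re_im (n1.trans s1.symm) (by linarith))
      rw [hns] at hn'
      linarith
    have : ((f n).im - y) ^ 2 = ((f s).im - y) ^ 2 := by linarith
    rcases sq_eq_sq_iff_eq_or_eq_neg.1 this with h | h
    · exact absurd h hne
    · linarith
  · rw [← sq_eq_sq_iff_abs_eq_abs]
    linarith

/-! ### Jensen's equation and conclusion -/

/-- Increments from `1` are additive, and positivity of `φ` makes them nonnegative, hence monotone
and linear. So `φ` is affine; a negative constant term contradicts positivity near `0`, and a
positive one contradicts surjectivity. -/
theorem eq_mul_of_jensen {φ : ℝ → ℝ} (hpos : ∀ y, 0 < y → 0 < φ y)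
    (hsurj : ∀ s, 0 < s → ∃ y, 0 < y ∧ φ y = s)
    (hJ : ∀ y r, 0 < r → r < y → φ (y + r) + φ (y - r) = 2 * φ y) :
    ∃ c, 0 < c ∧ ∀ y, 0 < y → φ y = c * y := by
  have hJ' : ∀ u v, 0 < u → 0 < v → φ u + φ v = 2 * φ ((u + v) / 2) := by
    have : ∀ u v, 0 < u → u < v → φ u + φ v = 2 * φ ((u + v) / 2) := by
      intro u v hu huv
      rw [← hJ ((u + v) / 2) ((v - u) / 2) (by linarith) (by linarith)]
      ring_nf
    intro u v hu hv
    rcases lt_trichotomy u v with h | rfl | h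
    · exact this u v hu h
    · ring_nf
    · rw [add_comm, this v u hv h, add_comm]
  have hadd : ∀ h k, 0 ≤ h → 0 ≤ k →
      φ (1 + (h + k)) - φ 1 = (φ (1 + h) - φ 1) + (φ (1 + k) - φ 1) := by
    intro h k hh hk
    have e1 := hJ' 1 (1 + (h + k)) one_pos (by linarith)
    have e2 := hJ' (1 + h) (1 + k) (by linarith) (by linarith)
    have : (1 + (1 + (h + k))) / 2 = (1 + h + (1 + k)) / 2 := by ring
    rw [this] at e1
    linarith
  have hn : ∀ (n : ℕ) (h : ℝ), 0 ≤ h → φ (1 + n * h) - φ 1 = n * (φ (1 + h) - φ 1) := by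
    intro n h hh
    induction n with
    | zero => simp
    | succ n ih =>
      have := hadd (n * h) h (by positivity) hh
      push_cast
      rw [add_one_mul, this, ih]
      ring
  have hD : ∀ h, 0 ≤ h → 0 ≤ φ (1 + h) - φ 1 := by
    intro h hh
    by_contra! hneg
    obtain ⟨n, hn'⟩ := exists_nat_gt (φ 1 / -(φ (1 + h) - φ 1))
    rw [div_lt_iff₀ (by linarith)] at hn'
    have := hn n h hh
    have := hpos (1 + n * h) (by positivity)
    linarith
  have hmono : ∀ h k, 0 ≤ h → h ≤ k → φ (1 + h) - φ 1 ≤ φ (1 + k) - φ 1 := by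
    intro h k hh hk
    have := hadd h (k - h) hh (by linarith)
    rw [add_sub_cancel] at this
    linarith [hD (k - h) (by linarith)]
  set d := φ (1 + 1) - φ 1 with hd
  have hd0 : 0 ≤ d := hD 1 zero_le_one
  have hN : ∀ n : ℕ, φ (1 + n) - φ 1 = n * d := fun n => by
    have := hn n 1 zero_le_one
    rwa [mul_one] at this
  have hlin : ∀ h, 0 ≤ h → φ (1 + h) - φ 1 = h * d := by
    intro h hh
    -- Squeezing `n * h` between consecutive integers bounds `n` times the error by `d`, uniformly
    -- in `n`.
    have hb : ∀ n : ℕ, n * |φ (1 + h) - φ 1 - h * d| ≤ d := by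
      intro n
      have hnh : 0 ≤ n * h := by positivity
      have f1 := Nat.floor_le hnh
      have f2 := (Nat.lt_floor_add_one (n * h)).le
      have g1 := hmono _ _ (Nat.cast_nonneg ⌊n * h⌋₊) f1
      have g2 := hmono (n * h) ((⌊n * h⌋₊ + 1 : ℕ) : ℝ) hnh (by push_cast; exact f2)
      rw [hN, hn n h hh] at g1
      rw [hN, hn n h hh] at g2
      push_cast at g2
      have k1 := mul_le_mul_of_nonneg_right f1 hd0
      have k2 := mul_le_mul_of_nonneg_right f2 hd0
      rw [← Nat.abs_cast n, ← abs_mul, abs_le]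
      constructor <;> nlinarith
    by_contra hne
    have hpos' : 0 < |φ (1 + h) - φ 1 - h * d| := abs_pos.2 (sub_ne_zero.2 hne)
    obtain ⟨n, hn'⟩ := exists_nat_gt (d / |φ (1 + h) - φ 1 - h * d|)
    rw [div_lt_iff₀ hpos'] at hn'
    linarith [hb n]
  have hall : ∀ y, 0 < y → φ y = (φ 1 - d) + d * y := by
    intro y hy
    rcases le_total 1 y with h | h
    · have := hlin (y - 1) (by linarith)
      rw [add_sub_cancel] at this
      linarith
    · have e1 := hJ' y (1 + (1 - y)) hy (by linarith)
      have e2 := hlin (1 - y) (by linarith)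
      have : (y + (1 + (1 - y))) / 2 = 1 := by ring
      rw [this] at e1
      linarith
  have hK : φ 1 - d = 0 := by
    rcases lt_trichotomy (φ 1 - d) 0 with h | h | h
    · exfalso
      have hd' : 0 < d := by linarith [hpos 1 one_pos]
      have hy : 0 < -(φ 1 - d) / (2 * d) := div_pos (by linarith) (by linarith)
      have h1 := hpos _ hy
      rw [hall _ hy] at h1
      have : d * (-(φ 1 - d) / (2 * d)) = -(φ 1 - d) / 2 := by field_simp
      linarith
    · exact h
    · exfalso
      obtain ⟨y, hy, h1⟩ := hsurj ((φ 1 - d) / 2) (by linarith)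
      rw [hall y hy] at h1
      have := mul_nonneg hd0 hy.le
      linarith
  refine ⟨d, by linarith [hpos 1 one_pos], fun y hy => ?_⟩
  rw [hall y hy, hK, zero_add]

theorem PreservesCurves.isometry_of_image_horizontal {f : ℍ ≃ ℍ} (hf : PreservesCurves f)
    {c c' : ℝ} (hc : 0 < c) (hc' : 0 < c') (hfc : f '' horizontal c = horizontal c') :
    Isometry f := by
  classical
  let pt : ℝ → ℝ → ℍ := fun x y => if h : 0 < y then ⟨⟨x, y⟩, h⟩ else UpperHalfPlane.I
  have pt_re : ∀ x y, 0 < y → (pt x y).re = x := fun x y h => by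
    simp only [pt, dif_pos h]; rfl
  have pt_im : ∀ x y, 0 < y → (pt x y).im = y := fun x y h => by
    simp only [pt, dif_pos h]; rfl
  have him : ∀ z w : ℍ, z.im = w.im → (f z).im = (f w).im := fun z w h => by
    have e := hf.im_eq hc' hfc w
    have : f z ∈ horizontal (f w).im := e ▸ Set.mem_image_of_mem f (show z.im = w.im from h)
    exact this
  have hpts : ∀ x y r, 0 < r → r < y → (f (pt x (y + r))).im + (f (pt x (y - r))).im =
      2 * (f (pt x y)).im ∧ |(f (pt x (y + r))).im - (f (pt x y)).im| =
        |(f (pt (x + r) y)).re - (f (pt x y)).re| := by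
    intro x y r hr hry
    have h0 : 0 < y := hr.trans hry
    have h1 : 0 < y + r := by linarith
    have h2 : 0 < y - r := by linarith
    apply hf.extreme_points hc hc' hfc hr <;> simp only [pt_re, pt_im, h0, h1, h2]
  obtain ⟨k, hk, hφ⟩ := eq_mul_of_jensen (φ := fun y => (f (pt 0 y)).im)
    (fun y _ => (f (pt 0 y)).im_pos)
    (fun s hs => ⟨(f.symm (pt 0 s)).im, (f.symm (pt 0 s)).im_pos, by
      rw [him _ (f.symm (pt 0 s)) (pt_im _ _ (f.symm (pt 0 s)).im_pos), f.apply_symm_apply,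
        pt_im _ _ hs]⟩)
    (fun y r hr hry => (hpts 0 y r hr hry).1)
  have hI : ∀ z, (f z).im = k * z.im := fun z => by
    rw [← hφ _ z.im_pos]
    exact him _ _ (pt_im _ _ z.im_pos).symm
  have hR : ∀ z w : ℍ, ((f z).re - (f w).re) ^ 2 = (k * (z.re - w.re)) ^ 2 := by
    intro z w
    wlog hle : w.re ≤ z.re generalizing z w
    · have := this w z (le_of_not_ge hle)
      linear_combination this
    rcases hle.eq_or_lt with heq | hlt
    · rw [hf.re_eq hc' hfc heq, heq]
      ring
    · have hr : 0 < z.re - w.re := by linarith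
      have hy : 0 < z.re - w.re + 1 := by linarith
      -- The centre is placed one unit higher than the radius, so that the circle stays inside the
      -- half-plane.
      have h := (hpts w.re (z.re - w.re + 1) (z.re - w.re) hr (by linarith)).2
      rw [hI, hI, pt_im _ _ hy, pt_im _ _ (by linarith), add_sub_cancel,
        hf.re_eq hc' hfc (pt_re z.re _ hy), hf.re_eq hc' hfc (pt_re w.re _ hy),
        ← sq_eq_sq_iff_abs_eq_abs] at h
      linear_combination -h
  refine isometry_of_forall_sq fun z w => ?_
  rw [hR, hI, hI]
  ring

theorem PreservesCurves.isometry {f : ℍ ≃ ℍ} (hf : PreservesCurves f) : Isometry f := by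
  obtain ⟨g, hg, hgc, c', hc', h⟩ := hf.exists_isometry_image_horizontal one_pos
  have hi := (hf.trans hgc).isometry_of_image_horizontal one_pos hc' h
  refine Isometry.of_dist_eq fun z w => ?_
  rw [← hg.dist_eq]
  exact hi.dist_eq z w

end HyperbolicPlane

theorem mainTheorem4 (f : UpperHalfPlane → UpperHalfPlane) (hf : Function.Bijective f)
    (hpres : ∀ C : Set UpperHalfPlane, HyperbolicPlane.IsConstantCurvatureCurve C →
      HyperbolicPlane.IsConstantCurvatureCurve (f '' C)) :
    Isometry f :=
  HyperbolicPlane.PreservesCurves.isometry (f := Equiv.ofBijective f hf) hpres
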